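/- **Proposition 3.2 (law of large numbers for the homozygosity of the hierarchical Pitman–Yor process).** *Notation.* For $a\in(0,1)$ and $t>-a$, the stick-breaking weights with discount $a$ and concentration $t$ are $V_i=U_i\prod_{k<i}(1-U_k)$, $i\ge1$, where $U_1,U_2,\ldots$ are independent and $U_k\sim\mathrm{Beta}(1-a,t+ka)$. The Pitman–Yor process with discount $a$, concentration $t$ and base distribution $\nu$ is $\sum_i V_i\delta_{\xi_i}$, where $\xi_1,\xi_2,\ldots$ are i.i.d. with law $\nu$ and independent of $(V_i)$. Write $(x)_{(n)}=x(x+1)\cdots(x+n-1)$, $$\mathscr C(m,j,\beta)=\frac1{j!}\sum_{k=0}^j(-1)^k\binom jk(-k\beta)_{(m)},\qquad M_{n,L}=\Big\{(n_1,\ldots,n_L)\in\mathbb Z_{\ge0}^L:\ \sum_{k}n_k=n\Big\}.$$ *Hierarchical process.* Let $\alpha,\beta\in(0,1)$, $\theta_0>-\alpha$, $\theta>-\beta$, let $L\ge1$ be an integer and let $\nu$ be a probability measure on a Polish space $S$. Let $\Xi_0=\sum_iV_i\delta_{\xi_i}$ be a Pitman–Yor process with discount $\alpha$, concentration $\theta_0$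 and base distribution $\nu$. Given $\Xi_0$ (that is, given its weights $V_i$ and its atoms $\xi_i$), let $\Xi^1,\ldots,\Xi^L$ be i.i.d. Pitman–Yor processes with discount $\beta$, concentration $\theta$ and base distribution $\Xi_0$: $\Xi^k=\sum_jV^k_j\delta_{\xi_{I^k_j}}$, where $(V^k_j)_{j\ge1}$ are stick-breaking weights with discount $\beta$ and concentration $\theta$, independent for different $k$ and independent of level one, and where, given level one and all $(V^k_j)$, the labels $I^k_j$ are independent with $P(I^k_j=i)=V_i$. The masses of group $k$ are $Z_{k,i}=\sum_{j:\,I^k_j=i}V^k_j$, so that $\Xi^k=\sum_iZ_{k,i}\delta_{\xi_i}$. For $m\ge2$ the homozygosity of order $m$ is $$H_{m,L}(\alpha,\theta_0,\beta,\theta)=\sum_{i=1}^\infty\ \sum_{(m_1,\ldots,m_L)\in M_{m,L}}\frac1{L^m}\prod_{k=1}^LZ_{k,i}^{m_k}.$$ *Asymptotic mean.* For $c\in(0,\infty)$ put $$A_j(\beta,m,L)=\sum_{(m_k)\in M_{m,L}}\ \sum_{(j_k)\in M_{j,L}}\ \prod_{k=1}^L\mathscr C(m_k,j_k,\beta),\qquad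 f(\alpha,\beta,\theta;m,L,c)=\frac1{L^m\theta^{m-1}}\sum_{j=1}^mA_j(\beta,m,L)\,\frac{(1-\alpha)_{(j-1)}}{\beta^jc^{j-1}}.$$ *Claim.* Let $\alpha,\beta\in(0,1)$, $c\in(0,\infty)$ and integers $m\ge2$, $L\ge1$ be fixed. As $\theta_0,\theta\to\infty$ in such a way that $\theta_0/\theta\to c$, $$\frac{H_{m,L}(\alpha,\theta_0,\beta,\theta)}{f(\alpha,\beta,\theta;m,L,c)}\ \longrightarrow\ 1\quad\text{in probability},$$ that is, for every $\varepsilon>0$, $P\left(\left|H_{m,L}(\alpha,\theta_0,\beta,\theta)/f(\alpha,\beta,\theta;m,L,c)-1\right|\ge\varepsilon\right)\to0$. -/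

import Mathlib

open MeasureTheory ProbabilityTheory Filter Topology
open scoped ENNReal

noncomputable section

namespace HPYP

/-! ### Stick breaking and the Pitman-Yor process -/

/-- The stick-breaking weights `V_k = u_k * ∏_{l < k} (1 - u_l)`; indices start at `0`, so that
`stick u k` is the weight usually written `V_{k+1}`. -/
def stick (u : ℕ → ℝ) (k : ℕ) : ℝ :=
  u k * ∏ l ∈ Finset.range k, (1 - u l)

/-- The discrete measure `∑_k V_k δ_{x_k}` with stick-breaking weights `V = stick u`. -/
def stickMeasure {S : Type*} [MeasurableSpace S] (u : ℕ → ℝ) (x : ℕ → S) : Measure S :=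
  Measure.sum fun k => ENNReal.ofReal (stick u k) • Measure.dirac (x k)

/-- Under `P`, the variables `U 0, U 1, …` are independent and `U k` has the law
`Beta(1 - a, t + (k + 1) a)`: the stick-breaking proportions with discount `a` and
concentration `t`. -/
structure IsSticks {Ω : Type*} [MeasurableSpace Ω] (P : Measure Ω) (a t : ℝ)
    (U : ℕ → Ω → ℝ) : Prop where
  measurable : ∀ k, Measurable (U k)
  law : ∀ k, P.map (U k) = betaMeasure (1 - a) (t + ((k : ℝ) + 1) * a)
  indep : iIndepFun U P

/-- Under `P`, the random measure `ω ↦ stickMeasure (U · ω) (ξ · ω)` is a Pitman-Yor process with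
discount `a`, concentration `t` and base distribution `ν`: the `U k` are the stick-breaking
proportions, and independently of them the atoms `ξ k` are i.i.d. with law `ν`. -/
structure IsPitmanYor {Ω S : Type*} [MeasurableSpace Ω] [MeasurableSpace S] (P : Measure Ω)
    (a t : ℝ) (ν : Measure S) (U : ℕ → Ω → ℝ) (ξ : ℕ → Ω → S) : Prop where
  sticks : IsSticks P a t U
  measurable_atom : ∀ k, Measurable (ξ k)
  law_atom : ∀ k, P.map (ξ k) = ν
  indep_atom : iIndepFun ξ P
  indep_sticks_atom : IndepFun (fun ω k => U k ω) (fun ω k => ξ k ω) P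

/-! ### The hierarchical Pitman-Yor process with `L` groups -/

/-- The hierarchical Pitman-Yor process with `L` groups, level one parameters `α, θ₀`, level two
parameters `β, θ` and base distribution `ν`.

* `U, ξ` are the sticks and atoms of the level one process `Ξ₀ = ∑_i V_i δ_{ξ_i}`.
* `U' g` are the sticks of the process of group `g`; they are independent over the groups and
  independent of level one.
* The atoms of the process of group `g` are draws from `Ξ₀`. The `j`-th one is `ξ_i` with
  `i = I g j`, where, conditionally on level one and on the sticks of all groups, the labels
  `I g j` are independent over all `g, j` and take the value `i` with probability `V_i`.

So, given level one, the random measures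
`Ξ^g = stickMeasure (U' g · ω) (fun j => ξ (I g j ω) ω)` are i.i.d. over `g`, each a Pitman-Yor
process with discount `β`, concentration `θ` and base distribution `Ξ₀`. -/
structure IsHierarchical {Ω S : Type*} [MeasurableSpace Ω] [MeasurableSpace S] (P : Measure Ω)
    (α θ₀ β θ : ℝ) (ν : Measure S) (L : ℕ) (U : ℕ → Ω → ℝ) (ξ : ℕ → Ω → S)
    (U' : Fin L → ℕ → Ω → ℝ) (I : Fin L → ℕ → Ω → ℕ) : Prop where
  level_one : IsPitmanYor P α θ₀ ν U ξ
  sticks : ∀ g, IsSticks P β θ (U' g)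
  indep_groups : iIndepFun (fun (g : Fin L) (ω : Ω) (k : ℕ) => U' g k ω) P
  indep_levels :
    IndepFun (fun ω => ((fun k => U k ω, fun k => ξ k ω) : (ℕ → ℝ) × (ℕ → S)))
      (fun ω (g : Fin L) (k : ℕ) => U' g k ω) P
  measurable_label : ∀ g j, Measurable (I g j)
  law_label : ∀ B : Set (((ℕ → ℝ) × (ℕ → S)) × (Fin L → ℕ → ℝ)), MeasurableSet B →
    ∀ (F : Finset (Fin L × ℕ)) (i : Fin L × ℕ → ℕ),
      P ({ω | ((fun k => U k ω, fun k => ξ k ω), fun g k => U' g k ω) ∈ B} ∩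
          {ω | ∀ p ∈ F, I p.1 p.2 ω = i p}) =
        ∫⁻ ω in {ω | ((fun k => U k ω, fun k => ξ k ω), fun g k => U' g k ω) ∈ B},
          ∏ p ∈ F, ENNReal.ofReal (stick (fun k => U k ω) (i p)) ∂P

/-- The masses of one group, `Z_i = ∑_{j : I_j = i} V'_j` where `V' = stick u'` are the weights of
the group and `I` are its labels: the mass that the group's process gives to the `i`-th atom of
level one. -/
def mass (u' : ℕ → ℝ) (I : ℕ → ℕ) (i : ℕ) : ℝ :=
  (stickMeasure u' I).real {i}

/-- The process of a group is `∑_i Z_i δ_{ξ_i}`, where `Z_i` are the masses of the group. -/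
theorem stickMeasure_comp_eq_sum {S : Type*} [MeasurableSpace S] (u' : ℕ → ℝ) (I : ℕ → ℕ)
    (ξ : ℕ → S) :
    stickMeasure u' (fun j => ξ (I j)) =
      Measure.sum fun i => stickMeasure u' I {i} • Measure.dirac (ξ i) := by
  have hξ : Measurable ξ := measurable_from_top
  have h1 : stickMeasure u' (fun j => ξ (I j)) = (stickMeasure u' I).map ξ := by
    unfold stickMeasure
    rw [Measure.map_sum hξ.aemeasurable]
    congr 1
    funext j
    rw [Measure.map_smul, Measure.map_dirac' hξ]
  have h2 := Measure.sum_smul_dirac (stickMeasure u' I)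
  rw [h1]
  conv_lhs => rw [← h2]
  rw [Measure.map_sum hξ.aemeasurable]
  congr 1
  funext j
  rw [Measure.map_smul, Measure.map_dirac' hξ]

/-! ### Homozygosity and its asymptotic mean -/

/-- `M_{n,L}`: the tuples `(n_1, …, n_L)` of natural numbers with sum `n`. -/
def tuples (n L : ℕ) : Finset (Fin L → ℕ) :=
  Finset.piAntidiag Finset.univ n

/-- The homozygosity of order `m` of `L` groups with masses `Z g i` (group `g`, atom `i`):
`∑_i ∑_{(m_1, …, m_L) ∈ M_{m,L}} L^{-m} ∏_g Z_{g,i}^{m_g}`. -/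
def homozygosity (m L : ℕ) (Z : Fin L → ℕ → ℝ) : ℝ :=
  ∑' i : ℕ, ∑ n ∈ tuples m L, (1 / (L : ℝ) ^ m) * ∏ g, Z g i ^ n g

/-- The rising factorial `x (x + 1) ⋯ (x + n - 1)`. -/
def rising (x : ℝ) (n : ℕ) : ℝ :=
  ∏ s ∈ Finset.range n, (x + s)

/-- The generalized factorial coefficient
`C(m, j, β) = (1 / j!) ∑_{k=0}^j (-1)^k (j choose k) (-k β)_{(m)}`. -/
def genFactCoeff (m j : ℕ) (β : ℝ) : ℝ :=
  (1 / (j.factorial : ℝ)) *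
    ∑ k ∈ Finset.range (j + 1), (-1 : ℝ) ^ k * (j.choose k : ℝ) * rising (-((k : ℝ) * β)) m

/-- `A_j(β, m, L) = ∑_{n ∈ M_{m,L}} ∑_{l ∈ M_{j,L}} ∏_g C(n_g, l_g, β)`. -/
def coeffA (j : ℕ) (β : ℝ) (m L : ℕ) : ℝ :=
  ∑ n ∈ tuples m L, ∑ l ∈ tuples j L, ∏ g, genFactCoeff (n g) (l g) β

/-- The asymptotic mean
`f = L^{-m} θ^{-(m-1)} ∑_{j=1}^m A_j(β, m, L) (1 - α)_{(j-1)} / (β^j c^{j-1})`. -/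
def asympMean (α β θ : ℝ) (m L : ℕ) (c : ℝ) : ℝ :=
  1 / ((L : ℝ) ^ m * θ ^ (m - 1)) *
    ∑ j ∈ Finset.Icc 1 m, coeffA j β m L * (rising (1 - α) (j - 1) / (β ^ j * c ^ (j - 1)))

end HPYP

end

/-!
The law of large numbers follows from Chebyshev's inequality once
`θ ^ (m - 1) * E[H]` and `θ ^ (2 m - 2) * E[H ^ 2]` converge to `f₀` and `f₀ ^ 2`, where
`f = f₀ / θ ^ (m - 1)`. Both moments have closed forms, so that the limits are taken term by term.

*One group.* If the base distribution gives the masses `p` and `q` to two distinct points, the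
moments `E[Z ^ n * Z' ^ n']` of the masses of the Pitman-Yor process at these points are polynomials
in `p` and `q` with coefficients
`θ (θ + β) ⋯ (θ + (j + j' - 1) β) / (θ)_(n + n') * C(n, j, β) C(n', j', β) / β ^ (j + j')`
(`groupMoment`, `massMoment_eq`). Removing the first stick turns the concentration `θ` into `θ + β`,
which gives a recursion for the moments (`massMoment_rec`). The polynomials satisfy the same
recursion by two recursions of the coefficients `C` (`genFactCoeff_succ_succ` and
`genFactCoeff_succ_succ_eq_sum`, `groupMoment_rec`). A bounded solution is unique, because the
product of the factors `E[(1 - U_l) ^ N]` diverges to zero (`eq_zero_of_rec`). In the same way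
`∑ V_i ^ J` and `∑_{i ≠ i'} V_i ^ J V_{i'} ^ K` are computed for the weights of level one
(`lintegral_powerSum`, `lintegral_pairSum`).

*All groups.* The conditional law of the labels given by `law_label` shows that, given the sticks of
level one, the pairs of sticks and labels of the groups are independent with the law `groupLaw`
(`IsHierarchical.lintegral_eq`, `lintegral_groups`). Multiplying the polynomials of the groups and
integrating over level one gives the expectations of `∑_i ∏_g Z_{g,i} ^ n_g` and of the
corresponding sum over pairs of atoms (`IsHierarchical.lintegral_atoms`,
`IsHierarchical.lintegral_atom_pairs`).

*Limit.* In `H ^ 2` the diagonal terms `i = i'` are sums over the atoms of total degree `2 m`, hence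
of order `θ ^ (1 - 2 m)` and negligible. In the off-diagonal terms the coefficients factorize
asymptotically, and the limit is the product of the limits of the means (`tendsto_atomPairMean`).

Expectations are lower Lebesgue integrals of `ℝ≥0∞`-valued functions, so that sums over atoms and
integrals commute without integrability conditions.
-/

noncomputable section

namespace HPYP

/-! ### Rising factorials -/

theorem rising_zero (x : ℝ) : rising x 0 = 1 := by simp [rising]

theorem rising_succ (x : ℝ) (n : ℕ) : rising x (n + 1) = rising x n * (x + n) := by
  simp [rising, Finset.prod_range_succ]

theorem rising_succ' (x : ℝ) (n : ℕ) : rising x (n + 1) = x * rising (x + 1) n := by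
  simp only [rising, Finset.prod_range_succ']
  rw [mul_comm]
  push_cast
  simp only [add_zero]
  congr 1
  exact Finset.prod_congr rfl fun s _ => by ring

theorem rising_pos {x : ℝ} (hx : 0 < x) (n : ℕ) : 0 < rising x n :=
  Finset.prod_pos fun s _ => by positivity

/-- The Chu-Vandermonde identity for rising factorials. -/
theorem rising_add (x y : ℝ) (n : ℕ) :
    rising (x + y) n =
      ∑ kl ∈ Finset.HasAntidiagonal.antidiagonal n,
        (n.choose kl.1 : ℝ) * (rising x kl.1 * rising y kl.2) := by
  induction n with
  | zero => simp [rising_zero]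
  | succ n ih =>
    rw [Finset.sum_antidiagonal_choose_succ_mul (fun i j => rising x i * rising y j),
      rising_succ, ih, ← Finset.sum_add_distrib, Finset.sum_mul]
    refine Finset.sum_congr rfl fun kl hkl => ?_
    have hn : (n : ℝ) = kl.1 + kl.2 := by
      rw [← Finset.HasAntidiagonal.mem_antidiagonal.1 hkl]; push_cast; ring
    have hc : n.choose kl.2 = n.choose kl.1 := by
      rw [← Finset.HasAntidiagonal.mem_antidiagonal.1 hkl, Nat.choose_symm_add]
    rw [hc, rising_succ, rising_succ, hn]
    ring

/-! ### Generalized factorial coefficients -/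

/-- `C(m, j, β) / β ^ j`: the sum of `∏ (1 - β)_{(|B| - 1)}` over the partitions of an `m`-set into
`j` blocks `B`. -/
def normCoeff (β : ℝ) (m j : ℕ) : ℝ :=
  genFactCoeff m j β / β ^ j

theorem genFactCoeff_succ_succ (m j : ℕ) (β : ℝ) :
    genFactCoeff (m + 1) (j + 1) β =
      (m - (j + 1) * β) * genFactCoeff m (j + 1) β + β * genFactCoeff m j β := by
  unfold genFactCoeff
  have h1 : ∑ k ∈ Finset.range (j + 1 + 1), (-1 : ℝ) ^ k * ((j + 1).choose k : ℝ) *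
        rising (-((k : ℝ) * β)) (m + 1) =
      (m - (j + 1) * β) * ∑ k ∈ Finset.range (j + 1 + 1), (-1 : ℝ) ^ k * ((j + 1).choose k : ℝ) *
        rising (-((k : ℝ) * β)) m +
      (j + 1) * β * ∑ k ∈ Finset.range (j + 1), (-1 : ℝ) ^ k * (j.choose k : ℝ) *
        rising (-((k : ℝ) * β)) m := by
    have h2 : ∑ k ∈ Finset.range (j + 1), (-1 : ℝ) ^ k * (j.choose k : ℝ) *
        rising (-((k : ℝ) * β)) m = ∑ k ∈ Finset.range (j + 1 + 1), (-1 : ℝ) ^ k *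
          (j.choose k : ℝ) * rising (-((k : ℝ) * β)) m := by
      rw [Finset.sum_range_succ _ (j + 1)]; simp
    rw [h2, Finset.mul_sum, Finset.mul_sum, ← Finset.sum_add_distrib]
    refine Finset.sum_congr rfl fun k hk => ?_
    have hk' : k ≤ j + 1 := by simpa [Nat.lt_succ_iff] using hk
    have h3 : ((j : ℝ) + 1) * (j.choose k : ℝ) = ((j + 1).choose k : ℝ) * (j + 1 - k) := by
      have h4 := Nat.choose_mul_succ_eq j k
      have h5 : ((j.choose k * (j + 1) : ℕ) : ℝ) = (((j + 1).choose k * (j + 1 - k) : ℕ) : ℝ) := by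
        rw [h4]
      push_cast [Nat.cast_sub hk'] at h5
      linarith
    rw [rising_succ]
    linear_combination (-(-1 : ℝ) ^ k * rising (-((k : ℝ) * β)) m * β) * h3
  rw [h1, Nat.factorial_succ]
  have : (j.factorial : ℝ) ≠ 0 := by positivity
  push_cast
  field_simp

theorem genFactCoeff_succ_zero (m : ℕ) (β : ℝ) : genFactCoeff (m + 1) 0 β = 0 := by
  simp [genFactCoeff, rising_succ']

theorem genFactCoeff_zero_zero (β : ℝ) : genFactCoeff 0 0 β = 1 := by
  simp [genFactCoeff, rising_zero]

theorem genFactCoeff_zero_succ (j : ℕ) (β : ℝ) : genFactCoeff 0 (j + 1) β = 0 := by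
  have := Int.alternating_sum_range_choose_of_ne (n := j + 1) (by omega)
  have h : (∑ k ∈ Finset.range (j + 1 + 1), (-1 : ℝ) ^ k * ((j + 1).choose k : ℝ)) = 0 := by
    exact_mod_cast this
  simp [genFactCoeff, rising_zero, h]

theorem genFactCoeff_eq_zero (β : ℝ) {m j : ℕ} (h : m < j) : genFactCoeff m j β = 0 := by
  induction m generalizing j with
  | zero => obtain ⟨i, rfl⟩ := Nat.exists_eq_succ_of_ne_zero h.ne'; exact genFactCoeff_zero_succ i β
  | succ m ih =>
    obtain ⟨i, rfl⟩ := Nat.exists_eq_succ_of_ne_zero (Nat.ne_zero_of_lt h)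
    rw [Nat.succ_eq_add_one, genFactCoeff_succ_succ, ih (by omega), ih (by omega)]
    simp

theorem genFactCoeff_self (β : ℝ) (m : ℕ) : genFactCoeff m m β = β ^ m := by
  induction m with
  | zero => simp [genFactCoeff_zero_zero]
  | succ m ih => rw [genFactCoeff_succ_succ, genFactCoeff_eq_zero β (Nat.lt_succ_self m), ih]; ring

theorem genFactCoeff_nonneg {β : ℝ} (h0 : 0 ≤ β) (h1 : β ≤ 1) (m j : ℕ) :
    0 ≤ genFactCoeff m j β := by
  induction m generalizing j with
  | zero =>
    rcases j with _ | j
    · simp [genFactCoeff_zero_zero]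
    · rw [genFactCoeff_zero_succ]
  | succ m ih =>
    rcases j with _ | j
    · rw [genFactCoeff_succ_zero]
    · rw [genFactCoeff_succ_succ]
      refine add_nonneg ?_ (mul_nonneg h0 (ih j))
      by_cases h : m < j + 1
      · rw [genFactCoeff_eq_zero β h, mul_zero]
      · refine mul_nonneg (sub_nonneg.2 ?_) (ih _)
        have : ((j : ℝ) + 1) ≤ m := by exact_mod_cast not_lt.1 h
        nlinarith

/-- The recursion obtained by removing the block that contains the last element. -/
theorem genFactCoeff_succ_succ_eq_sum (m j : ℕ) (β : ℝ) :
    genFactCoeff (m + 1) (j + 1) β = β * ∑ kl ∈ Finset.HasAntidiagonal.antidiagonal m,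
      (m.choose kl.1 : ℝ) * (rising (1 - β) kl.1 * genFactCoeff kl.2 j β) := by
  have hR : ∑ kl ∈ Finset.HasAntidiagonal.antidiagonal m,
      (m.choose kl.1 : ℝ) * (rising (1 - β) kl.1 * genFactCoeff kl.2 j β) =
      1 / (j.factorial : ℝ) * ∑ i ∈ Finset.range (j + 1), (-1 : ℝ) ^ i * (j.choose i : ℝ) *
        rising (1 - β + -((i : ℝ) * β)) m := by
    simp_rw [rising_add, genFactCoeff, Finset.mul_sum]
    rw [Finset.sum_comm]
    refine Finset.sum_congr rfl fun i _ => Finset.sum_congr rfl fun kl _ => by ring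
  rw [hR, genFactCoeff, Finset.sum_range_succ', Nat.factorial_succ]
  have hz : rising (-(((0 : ℕ) : ℝ) * β)) (m + 1) = 0 := by simp [rising_succ']
  rw [hz, mul_zero, add_zero]
  have : (j.factorial : ℝ) ≠ 0 := by positivity
  simp_rw [Finset.mul_sum]
  refine Finset.sum_congr rfl fun i _ => ?_
  have h3 : ((j : ℝ) + 1) * (j.choose i : ℝ) = ((j + 1).choose (i + 1) : ℝ) * (i + 1) := by
    exact_mod_cast Nat.add_one_mul_choose_eq j i
  have h4 : -(((i + 1 : ℕ) : ℝ) * β) + 1 = 1 - β + -((i : ℝ) * β) := by push_cast; ring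
  rw [rising_succ', h4]
  push_cast
  field_simp
  rw [pow_succ]
  linear_combination ((-1 : ℝ) ^ i * β * rising (1 - β + -((i : ℝ) * β)) m) * (-h3)

theorem normCoeff_succ_succ {β : ℝ} (hβ : β ≠ 0) (m j : ℕ) :
    normCoeff β (m + 1) (j + 1) =
      (m - (j + 1) * β) * normCoeff β m (j + 1) + normCoeff β m j := by
  simp only [normCoeff, genFactCoeff_succ_succ]
  field_simp
  ring

theorem normCoeff_succ_succ_eq_sum {β : ℝ} (hβ : β ≠ 0) (m j : ℕ) :
    normCoeff β (m + 1) (j + 1) = ∑ kl ∈ Finset.HasAntidiagonal.antidiagonal m,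
      (m.choose kl.1 : ℝ) * (rising (1 - β) kl.1 * normCoeff β kl.2 j) := by
  simp only [normCoeff, genFactCoeff_succ_succ_eq_sum, Finset.mul_sum, Finset.sum_div]
  refine Finset.sum_congr rfl fun kl _ => ?_
  field_simp
  ring

theorem normCoeff_eq_zero (β : ℝ) {m j : ℕ} (h : m < j) : normCoeff β m j = 0 := by
  simp [normCoeff, genFactCoeff_eq_zero β h]

theorem normCoeff_zero_right {β : ℝ} {m : ℕ} (h : m ≠ 0) : normCoeff β m 0 = 0 := by
  obtain ⟨k, rfl⟩ := Nat.exists_eq_succ_of_ne_zero h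
  simp [normCoeff, genFactCoeff_succ_zero]

theorem normCoeff_nonneg {β : ℝ} (h0 : 0 ≤ β) (h1 : β ≤ 1) (m j : ℕ) : 0 ≤ normCoeff β m j :=
  div_nonneg (genFactCoeff_nonneg h0 h1 m j) (pow_nonneg h0 j)

/-! ### Moment formulas and their recursions -/

/-- The mixed moment `E[u ^ k * (1 - u) ^ l]` of the first stick `u ∼ Beta(1 - a, t + a)`. -/
def stickMoment (a t : ℝ) (k l : ℕ) : ℝ :=
  rising (1 - a) k * rising (t + a) l / rising (t + 1) (k + l)

/-- The product `θ (θ + β) ⋯ (θ + (j - 1) β)`. -/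
def stepProd (β θ : ℝ) (j : ℕ) : ℝ :=
  ∏ l ∈ Finset.range j, (θ + l * β)

/-- The factor `θ (θ + β) ⋯ (θ + (j - 1) β) / (θ)_{(n)}` of the exchangeable partition probability
function of a sample of size `n` with `j` blocks. The usual form has the common factor `θ` removed,
which is the same for `θ > 0` and `n, j ≥ 1`. -/
def blockFactor (β θ : ℝ) (j n : ℕ) : ℝ :=
  stepProd β θ j / rising θ n

/-- The moment `E[Z_i ^ n * Z_{i'} ^ n']` of the masses of a Pitman-Yor process with discount `β`
and concentration `θ` at two points to which the base distribution gives the masses `p` and `q`.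
The summands with `j > n` or `j' > n'` vanish, so that any `K > max n n'` gives the same value. -/
def groupMoment (β θ : ℝ) (K : ℕ) (p q : ℝ) (n n' : ℕ) : ℝ :=
  ∑ j ∈ Finset.range K, ∑ j' ∈ Finset.range K,
    p ^ j * q ^ j' * (blockFactor β θ (j + j') (n + n') * (normCoeff β n j * normCoeff β n' j'))

theorem sum_range_shift {M : Type*} [AddCommMonoid M] [IsCancelAdd M] (g : ℕ → M) (K : ℕ)
    (h0 : g 0 = 0) (hK : g K = 0) :
    ∑ j ∈ Finset.range K, g (j + 1) = ∑ j ∈ Finset.range K, g j := by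
  have h := Finset.sum_range_succ' g K
  rw [Finset.sum_range_succ, hK, h0, add_zero, add_zero] at h
  exact h.symm

theorem stepProd_succ (β θ : ℝ) (j : ℕ) :
    stepProd β θ (j + 1) = stepProd β θ j * (θ + j * β) :=
  Finset.prod_range_succ _ _

theorem stepProd_succ' (β θ : ℝ) (j : ℕ) :
    stepProd β θ (j + 1) = θ * stepProd β (θ + β) j := by
  unfold stepProd
  rw [Finset.prod_range_succ', mul_comm]
  simp only [Nat.cast_zero, zero_mul, add_zero]
  congr 1
  refine Finset.prod_congr rfl fun l _ => ?_
  push_cast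
  ring

theorem rising_add_one_eq (x : ℝ) (hx : x ≠ 0) (n : ℕ) :
    rising (x + 1) n = rising x n * (x + n) / x := by
  rw [← rising_succ, rising_succ', mul_div_cancel_left₀ _ hx]

section Recursion

variable {β θ : ℝ}

theorem sum_choose_mul_groupMoment (hβ : 0 < β) (hθ : 0 < θ) (K : ℕ) (p q : ℝ) (n n' : ℕ) :
    ∑ kl ∈ Finset.HasAntidiagonal.antidiagonal n, (n.choose kl.1 : ℝ) *
        (stickMoment β θ kl.1 (kl.2 + n') * groupMoment β (θ + β) K p q kl.2 n') =
      (∑ j ∈ Finset.range K, ∑ j' ∈ Finset.range K, p ^ j * q ^ j' *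
        (stepProd β (θ + β) (j + j') *
          (normCoeff β (n + 1) (j + 1) * normCoeff β n' j'))) / rising (θ + 1) (n + n') := by
  simp_rw [normCoeff_succ_succ_eq_sum hβ.ne', groupMoment, Finset.mul_sum, Finset.sum_mul,
    Finset.sum_div, Finset.mul_sum, Finset.sum_div]
  rw [Finset.sum_comm]
  refine Finset.sum_congr rfl fun j _ => ?_
  rw [Finset.sum_comm]
  refine Finset.sum_congr rfl fun j' _ => Finset.sum_congr rfl fun kl hkl => ?_
  have h1 : kl.1 + (kl.2 + n') = n + n' := by
    rw [← Finset.HasAntidiagonal.mem_antidiagonal.1 hkl]; ring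
  have h2 : rising (θ + β) (kl.2 + n') ≠ 0 := (rising_pos (by linarith) _).ne'
  rw [stickMoment, blockFactor, h1]
  field_simp

theorem groupMoment_swap (K : ℕ) (p q : ℝ) (n n' : ℕ) :
    groupMoment β θ K p q n n' = groupMoment β θ K q p n' n := by
  unfold groupMoment
  rw [Finset.sum_comm]
  refine Finset.sum_congr rfl fun j _ => Finset.sum_congr rfl fun j' _ => ?_
  rw [add_comm j' j, add_comm n' n]
  ring

/-- The recursion obtained by removing the first stick: its label is the first point with
probability `p`, the second one with probability `q`, and neither otherwise. -/
theorem groupMoment_rec (hβ : 0 < β) (hθ : 0 < θ) {K : ℕ} (p q : ℝ) {n n' : ℕ} (hn : n < K)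
    (hn' : n' < K) :
    groupMoment β θ K p q n n' =
      p * ∑ kl ∈ Finset.HasAntidiagonal.antidiagonal n, (n.choose kl.1 : ℝ) *
          (stickMoment β θ kl.1 (kl.2 + n') * groupMoment β (θ + β) K p q kl.2 n') +
        q * ∑ kl ∈ Finset.HasAntidiagonal.antidiagonal n', (n'.choose kl.1 : ℝ) *
          (stickMoment β θ kl.1 (kl.2 + n) * groupMoment β (θ + β) K p q n kl.2) +
        (1 - p - q) * (stickMoment β θ 0 (n + n') * groupMoment β (θ + β) K p q n n') := by
  have hr : rising (θ + 1) (n + n') ≠ 0 := (rising_pos (by linarith) _).ne'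
  have hr' : rising θ (n + n') ≠ 0 := (rising_pos hθ _).ne'
  have hr'' : rising (θ + β) (n + n') ≠ 0 := (rising_pos (by linarith) _).ne'
  have hz : ∀ x : ℕ, (x : ℝ) * normCoeff β x 0 = 0 := fun x => by
    rcases eq_or_ne x 0 with rfl | h
    · simp
    · rw [normCoeff_zero_right h, mul_zero]
  -- the common form of the summands: `W j j'` is the weight and the other factor counts blocks
  set W : ℕ → ℕ → ℝ := fun j j' => p ^ j * q ^ j' *
    (stepProd β θ (j + j') / θ * (normCoeff β n j * normCoeff β n' j'))
    with hW
  have e0 : groupMoment β θ K p q n n' * rising (θ + 1) (n + n') =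
      ∑ j ∈ Finset.range K, ∑ j' ∈ Finset.range K, W j j' * (θ + (n + n')) := by
    rw [rising_add_one_eq θ hθ.ne']
    simp_rw [groupMoment, Finset.sum_mul, blockFactor, hW]
    refine Finset.sum_congr rfl fun j _ => Finset.sum_congr rfl fun j' _ => ?_
    push_cast
    field_simp
  have e3 : stickMoment β θ 0 (n + n') * groupMoment β (θ + β) K p q n n' *
        rising (θ + 1) (n + n') =
      ∑ j ∈ Finset.range K, ∑ j' ∈ Finset.range K, W j j' * (θ + (j + j') * β) := by
    simp_rw [groupMoment, stickMoment, Finset.mul_sum, Finset.sum_mul, blockFactor, hW]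
    refine Finset.sum_congr rfl fun j _ => Finset.sum_congr rfl fun j' _ => ?_
    have h1 := stepProd_succ' β θ (j + j')
    rw [stepProd_succ] at h1
    rw [zero_add, rising_zero]
    push_cast at h1
    field_simp
    linear_combination (-p ^ j * q ^ j' * normCoeff β n j * normCoeff β n' j') * h1
  have key : ∀ (p q : ℝ) (n n' : ℕ), n < K →
      p * ∑ j ∈ Finset.range K, ∑ j' ∈ Finset.range K, p ^ j * q ^ j' *
        (stepProd β (θ + β) (j + j') *
          (normCoeff β (n + 1) (j + 1) * normCoeff β n' j')) =
      ∑ j ∈ Finset.range K, ∑ j' ∈ Finset.range K, p ^ j * q ^ j' *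
        (stepProd β θ (j + j') / θ * (normCoeff β n j * normCoeff β n' j')) *
          (n - j * β) +
      p * ∑ j ∈ Finset.range K, ∑ j' ∈ Finset.range K, p ^ j * q ^ j' *
        (stepProd β θ (j + j') / θ * (normCoeff β n j * normCoeff β n' j')) *
          (θ + (j + j') * β) := by
    intro p q n n' hn
    rw [← sum_range_shift (fun j => ∑ j' ∈ Finset.range K, p ^ j * q ^ j' *
        (stepProd β θ (j + j') / θ * (normCoeff β n j * normCoeff β n' j')) *
          (n - j * β)) K]
    · simp_rw [Finset.mul_sum, ← Finset.sum_add_distrib]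
      refine Finset.sum_congr rfl fun j _ => Finset.sum_congr rfl fun j' _ => ?_
      have h1 := stepProd_succ' β θ (j + j')
      have h2 : stepProd β θ (j + 1 + j') =
          θ * stepProd β (θ + β) (j + j') := by
        rw [← h1, add_right_comm]
      rw [stepProd_succ] at h1
      rw [h2, normCoeff_succ_succ hβ.ne']
      push_cast at h1 ⊢
      field_simp
      linear_combination (-p * p ^ j * q ^ j' * normCoeff β n j * normCoeff β n' j') * h1
    · refine Finset.sum_eq_zero fun j' _ => ?_
      have := hz n
      push_cast
      linear_combination (p ^ 0 * q ^ j' * (stepProd β θ (0 + j') / θ *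
        normCoeff β n' j')) * this
    · refine Finset.sum_eq_zero fun j' _ => ?_
      rw [normCoeff_eq_zero β hn]
      ring
  have e1 := key p q n n' hn
  have e2 := key q p n' n hn'
  have hs : ∀ kl : ℕ × ℕ, groupMoment β (θ + β) K p q n kl.2 =
    groupMoment β (θ + β) K q p kl.2 n := fun kl => groupMoment_swap _ _ _ _ _
  simp_rw [hs]
  rw [sum_choose_mul_groupMoment hβ hθ, sum_choose_mul_groupMoment hβ hθ, add_comm n' n]
  have hsw : ∀ f : ℕ → ℕ → ℝ, (∑ j ∈ Finset.range K, ∑ j' ∈ Finset.range K, q ^ j * p ^ j' *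
        (stepProd β θ (j + j') / θ * (normCoeff β n' j * normCoeff β n j')) *
          f j j') = ∑ j ∈ Finset.range K, ∑ j' ∈ Finset.range K, W j j' * f j' j := by
    intro f
    rw [Finset.sum_comm]
    refine Finset.sum_congr rfl fun j _ => Finset.sum_congr rfl fun j' _ => ?_
    rw [hW, add_comm j' j]
    ring
  rw [hsw (fun j _ => n' - j * β), hsw (fun j j' => θ + (j + j') * β)] at e2
  have e4 : ∑ j ∈ Finset.range K, ∑ j' ∈ Finset.range K, W j j' * (θ + (n + n')) =
      ∑ j ∈ Finset.range K, ∑ j' ∈ Finset.range K, W j j' * (n - j * β) +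
      ∑ j ∈ Finset.range K, ∑ j' ∈ Finset.range K, W j j' * (n' - j' * β) +
      ∑ j ∈ Finset.range K, ∑ j' ∈ Finset.range K, W j j' * (θ + (j + j') * β) := by
    simp_rw [← Finset.sum_add_distrib]
    refine Finset.sum_congr rfl fun j _ => Finset.sum_congr rfl fun j' _ => ?_
    ring
  have e5 : ∑ j ∈ Finset.range K, ∑ j' ∈ Finset.range K, W j j' * (θ + ((j' : ℝ) + j) * β) =
      ∑ j ∈ Finset.range K, ∑ j' ∈ Finset.range K, W j j' * (θ + (j + j') * β) := by
    refine Finset.sum_congr rfl fun j _ => Finset.sum_congr rfl fun j' _ => ?_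
    ring
  rw [e5] at e2
  refine mul_right_cancel₀ hr ?_
  rw [add_mul, add_mul, mul_assoc (1 - p - q), e3, e0, mul_assoc p, mul_assoc q,
    div_mul_cancel₀ _ hr, div_mul_cancel₀ _ hr, e1, e2, e4]
  ring

theorem groupMoment_zero_zero {K : ℕ} (hK : 0 < K) (p q : ℝ) :
    groupMoment β θ K p q 0 0 = 1 := by
  obtain ⟨k, rfl⟩ := Nat.exists_eq_succ_of_ne_zero hK.ne'
  have h0 : normCoeff β 0 0 = 1 := by simp [normCoeff, genFactCoeff_zero_zero]
  have hs : ∀ j, normCoeff β 0 (j + 1) = 0 := fun j => normCoeff_eq_zero β (Nat.succ_pos j)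
  simp [groupMoment, Finset.sum_range_succ', h0, hs, blockFactor, rising_zero, stepProd]

end Recursion

/-- The moment `E[∑_i V_i ^ (J + 1)]` of the stick-breaking weights. -/
def powerSumMoment (a t : ℝ) (J : ℕ) : ℝ :=
  rising (1 - a) J / rising (t + 1) J

/-- The moment `E[∑_{i ≠ i'} V_i ^ (J + 1) * V_{i'} ^ (K + 1)]` of the stick-breaking weights. -/
def pairSumMoment (a t : ℝ) (J K : ℕ) : ℝ :=
  (t + a) * rising (1 - a) J * rising (1 - a) K / rising (t + 1) (J + K + 1)

theorem powerSumMoment_rec {a t : ℝ} (ha : 0 < a) (ht : 0 < t) (J : ℕ) :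
    powerSumMoment a t J =
      stickMoment a t (J + 1) 0 + stickMoment a t 0 (J + 1) * powerSumMoment a (t + a) J := by
  have h1 : rising (t + a + 1) J ≠ 0 := (rising_pos (by linarith) _).ne'
  have h2 : rising (t + 1) J ≠ 0 := (rising_pos (by linarith) _).ne'
  have h3 : t + 1 + J ≠ 0 := by positivity
  simp only [powerSumMoment, stickMoment, add_zero, zero_add, rising_zero]
  rw [rising_succ' (t + a), rising_succ, rising_succ]
  field_simp
  ring

theorem pairSumMoment_rec {a t : ℝ} (ha : 0 < a) (ht : 0 < t) (J K : ℕ) :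
    pairSumMoment a t J K =
      stickMoment a t (J + 1) (K + 1) * powerSumMoment a (t + a) K +
        stickMoment a t (K + 1) (J + 1) * powerSumMoment a (t + a) J +
        stickMoment a t 0 (J + K + 2) * pairSumMoment a (t + a) J K := by
  have h1 : ∀ J, rising (t + a + 1) J ≠ 0 := fun J => (rising_pos (by linarith) _).ne'
  have h2 : rising (t + 1) (J + K + 1) ≠ 0 := (rising_pos (by linarith) _).ne'
  have h3 : t + 1 + ((J + K + 1 : ℕ) : ℝ) ≠ 0 := by positivity
  have h4 := h1 J
  have h5 := h1 K
  have h6 := h1 (J + K + 1)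
  have e1 : J + 1 + (K + 1) = J + K + 1 + 1 := by ring
  have e2 : K + 1 + (J + 1) = J + K + 1 + 1 := by ring
  have e3 : J + K + 2 = J + K + 1 + 1 := by ring
  simp only [powerSumMoment, pairSumMoment, stickMoment, zero_add, rising_zero, e1, e2, e3]
  rw [rising_succ' (t + a) K, rising_succ' (t + a) J, rising_succ' (t + a) (J + K + 1),
    rising_succ (t + 1) (J + K + 1), rising_succ (1 - a) J, rising_succ (1 - a) K]
  field_simp
  push_cast
  ring

/-! ### Uniqueness of the solutions of the recursions -/

theorem rising_le_rising {x y : ℝ} (hx : 0 ≤ x) (hxy : x ≤ y) (n : ℕ) :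
    rising x n ≤ rising y n :=
  Finset.prod_le_prod (fun s _ => by positivity) fun s _ => by linarith

theorem stickMoment_nonneg {a t : ℝ} (ha0 : 0 ≤ a) (ha1 : a < 1) (ht : 0 < t) (k l : ℕ) :
    0 ≤ stickMoment a t k l := by
  have h1 := (rising_pos (sub_pos.2 ha1) k).le
  have h2 := (rising_pos (show 0 < t + a by linarith) l).le
  have h3 := (rising_pos (show 0 < t + 1 by linarith) (k + l)).le
  exact div_nonneg (mul_nonneg h1 h2) h3

theorem stickMoment_zero_succ_le {a t : ℝ} (ha0 : 0 ≤ a) (ha1 : a < 1) (ht : 0 < t) (N : ℕ) :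
    stickMoment a t 0 (N + 1) ≤ 1 - (1 - a) / (t + 1) := by
  have h1 : 0 < t + 1 := by linarith
  have h2 : 0 < rising (t + 1 + 1) N := rising_pos (by linarith) N
  have h3 := rising_le_rising (x := t + a + 1) (y := t + 1 + 1) (by linarith) (by linarith) N
  rw [stickMoment, zero_add, rising_zero, one_mul, rising_succ', rising_succ',
    show 1 - (1 - a) / (t + 1) = (t + a) / (t + 1) by field_simp; ring, mul_div_mul_comm]
  exact mul_le_of_le_one_right (by positivity) (div_le_one_of_le₀ h3 h2.le)

/-- The only bounded solution of `D l = E[(1 - U_l) ^ (N + 1)] * D (l + 1)` is zero at `0`, since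
the product of the moments diverges to zero like `exp (-∑ (1 - a) / (t + l a + 1))`. -/
theorem eq_zero_of_rec {a t : ℝ} (ha0 : 0 ≤ a) (ha1 : a < 1) (ht : 0 < t) (N : ℕ) (D : ℕ → ℝ)
    (C : ℝ) (hC : ∀ l, |D l| ≤ C)
    (hD : ∀ l : ℕ, D l = stickMoment a (t + l * a) 0 (N + 1) * D (l + 1)) : D 0 = 0 := by
  have hC0 : 0 ≤ C := (abs_nonneg _).trans (hC 0)
  set κ := (1 - a) / (t + 1 + a)
  have hκ : 0 < κ := div_pos (by linarith) (by linarith)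
  have hr : ∀ l : ℕ, stickMoment a (t + l * a) 0 (N + 1) ≤
      Real.exp (-(κ * (1 / ((l : ℝ) + 1)))) := by
    intro l
    have hl : 0 ≤ (l : ℝ) * a := by positivity
    refine (stickMoment_zero_succ_le ha0 ha1 (by linarith) N).trans ?_
    have h1 : κ * (1 / ((l : ℝ) + 1)) ≤ (1 - a) / (t + l * a + 1) := by
      rw [div_mul_div_comm, mul_one]
      refine div_le_div_of_nonneg_left (by linarith) (by linarith) ?_
      nlinarith [show (0 : ℝ) ≤ l from l.cast_nonneg]
    have h2 := Real.add_one_le_exp (-(κ * (1 / ((l : ℝ) + 1))))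
    linarith
  have hn : ∀ n : ℕ, |D 0| ≤ Real.exp (-(κ * ∑ l ∈ Finset.range n, 1 / ((l : ℝ) + 1))) * |D n| := by
    intro n
    induction n with
    | zero => simp
    | succ n ih =>
      refine ih.trans ?_
      rw [Finset.sum_range_succ, mul_add, neg_add, Real.exp_add, mul_assoc]
      refine mul_le_mul_of_nonneg_left ?_ (Real.exp_nonneg _)
      rw [hD n, abs_mul, abs_of_nonneg (stickMoment_nonneg ha0 ha1 (by positivity) _ _)]
      exact mul_le_mul_of_nonneg_right (hr n) (abs_nonneg _)
  have hlim : Tendsto (fun n : ℕ => Real.exp (-(κ * ∑ l ∈ Finset.range n, 1 / ((l : ℝ) + 1))) * C)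
      atTop (𝓝 (0 * C)) := by
    refine Tendsto.mul_const C (Real.tendsto_exp_neg_atTop_nhds_zero.comp ?_)
    exact Real.tendsto_sum_range_one_div_nat_succ_atTop.const_mul_atTop hκ
  rw [zero_mul] at hlim
  have := ge_of_tendsto' hlim fun n => (hn n).trans
    (mul_le_mul_of_nonneg_left (hC n) (Real.exp_nonneg _))
  exact abs_nonpos_iff.1 this

theorem blockFactor_nonneg {β θ : ℝ} (hβ0 : 0 ≤ β) (hθ : 0 < θ) (j n : ℕ) :
    0 ≤ blockFactor β θ j n :=
  div_nonneg (Finset.prod_nonneg fun l _ => by positivity) (rising_pos hθ n).le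

theorem blockFactor_le_one {β θ : ℝ} (hβ0 : 0 ≤ β) (hβ1 : β ≤ 1) (hθ : 0 < θ) {j n : ℕ}
    (hj : j ≠ 0) (hjn : j ≤ n) : blockFactor β θ j n ≤ 1 := by
  refine div_le_one_of_le₀ ?_ (rising_pos hθ n).le
  rw [rising, stepProd, ← Finset.prod_range_mul_prod_Ico _ hjn]
  have h1 : ∏ l ∈ Finset.range j, (θ + l * β) ≤ ∏ l ∈ Finset.range j, (θ + l) :=
    Finset.prod_le_prod (fun l _ => by positivity) fun l _ => by
      have : (l : ℝ) * β ≤ l := mul_le_of_le_one_right l.cast_nonneg hβ1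
      linarith
  have h2 : (1 : ℝ) ≤ ∏ l ∈ Finset.Ico j n, (θ + l) := by
    rw [← Finset.prod_const_one (s := Finset.Ico j n)]
    refine Finset.prod_le_prod (fun _ _ => zero_le_one) fun l hl => ?_
    have : (1 : ℝ) ≤ l := by
      exact_mod_cast (Nat.one_le_iff_ne_zero.2 hj).trans (Finset.mem_Ico.1 hl).1
    linarith
  exact h1.trans (le_mul_of_one_le_right (Finset.prod_nonneg fun l _ => by positivity) h2)

theorem blockFactor_mul_normCoeff_le {β θ : ℝ} (hβ0 : 0 ≤ β) (hβ1 : β ≤ 1) (hθ : 0 < θ)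
    (n n' j j' : ℕ) :
    blockFactor β θ (j + j') (n + n') * (normCoeff β n j * normCoeff β n' j') ≤
      normCoeff β n j * normCoeff β n' j' := by
  have hc := mul_nonneg (normCoeff_nonneg hβ0 hβ1 n j) (normCoeff_nonneg hβ0 hβ1 n' j')
  rcases lt_or_ge n j with h | h
  · simp [normCoeff_eq_zero β h]
  rcases lt_or_ge n' j' with h' | h'
  · simp [normCoeff_eq_zero β h']
  rcases eq_or_ne (j + j') 0 with h0 | h0
  · obtain ⟨rfl, rfl⟩ : j = 0 ∧ j' = 0 := by omega
    rcases eq_or_ne n 0 with rfl | hn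
    · rcases eq_or_ne n' 0 with rfl | hn'
      · simp [blockFactor, stepProd, rising_zero]
      · simp [normCoeff_zero_right hn']
    · simp [normCoeff_zero_right hn]
  · exact mul_le_of_le_one_left hc (blockFactor_le_one hβ0 hβ1 hθ h0 (by omega))

theorem groupMoment_nonneg {β θ : ℝ} (hβ0 : 0 ≤ β) (hβ1 : β ≤ 1) (hθ : 0 < θ) (K : ℕ) {p q : ℝ}
    (hp : 0 ≤ p) (hq : 0 ≤ q) (n n' : ℕ) : 0 ≤ groupMoment β θ K p q n n' :=
  Finset.sum_nonneg fun j _ => Finset.sum_nonneg fun j' _ => mul_nonneg (by positivity)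
    (mul_nonneg (blockFactor_nonneg hβ0 hθ _ _)
      (mul_nonneg (normCoeff_nonneg hβ0 hβ1 n j) (normCoeff_nonneg hβ0 hβ1 n' j')))

theorem groupMoment_le {β θ : ℝ} (hβ0 : 0 ≤ β) (hβ1 : β ≤ 1) (hθ : 0 < θ) (K : ℕ) {p q : ℝ}
    (hp : 0 ≤ p) (hq : 0 ≤ q) (n n' : ℕ) :
    groupMoment β θ K p q n n' ≤ ∑ j ∈ Finset.range K, ∑ j' ∈ Finset.range K,
      p ^ j * q ^ j' * (normCoeff β n j * normCoeff β n' j') :=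
  Finset.sum_le_sum fun j _ => Finset.sum_le_sum fun j' _ =>
    mul_le_mul_of_nonneg_left (blockFactor_mul_normCoeff_le hβ0 hβ1 hθ n n' j j') (by positivity)

/-- A bounded family that satisfies the recursion of `groupMoment` is `groupMoment`. -/
theorem eq_groupMoment_of_rec {β : ℝ} (hβ0 : 0 < β) (hβ1 : β < 1) (K : ℕ) {p q : ℝ}
    (hp : 0 ≤ p) (hq : 0 ≤ q) (M : ℝ → ℕ → ℕ → ℝ)
    (hM0 : ∀ θ, 0 < θ → ∀ n n', 0 ≤ M θ n n') (hM1 : ∀ θ, 0 < θ → ∀ n n', M θ n n' ≤ 1)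
    (hM00 : ∀ θ, 0 < θ → M θ 0 0 = 1)
    (hrec : ∀ θ, 0 < θ → ∀ n n', M θ n n' =
      p * ∑ kl ∈ Finset.HasAntidiagonal.antidiagonal n, (n.choose kl.1 : ℝ) *
          (stickMoment β θ kl.1 (kl.2 + n') * M (θ + β) kl.2 n') +
        q * ∑ kl ∈ Finset.HasAntidiagonal.antidiagonal n', (n'.choose kl.1 : ℝ) *
          (stickMoment β θ kl.1 (kl.2 + n) * M (θ + β) n kl.2) +
        (1 - p - q) * (stickMoment β θ 0 (n + n') * M (θ + β) n n'))
    {θ : ℝ} (hθ : 0 < θ) {n n' : ℕ} (hn : n < K) (hn' : n' < K) :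
    M θ n n' = groupMoment β θ K p q n n' := by
  obtain ⟨N, hN⟩ : ∃ N, N = n + n' := ⟨_, rfl⟩
  induction N using Nat.strong_induction_on generalizing θ n n' with
  | _ N ih =>
  rcases Nat.eq_zero_or_pos N with h0 | hpos
  · obtain ⟨rfl, rfl⟩ : n = 0 ∧ n' = 0 := by omega
    rw [hM00 θ hθ, groupMoment_zero_zero hn]
  obtain ⟨N, rfl⟩ := Nat.exists_eq_succ_of_ne_zero hpos.ne'
  have hl : ∀ l : ℕ, 0 < θ + l * β := fun l => by positivity
  have h := eq_zero_of_rec hβ0.le hβ1 hθ N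
    (fun l => M (θ + l * β) n n' - groupMoment β (θ + l * β) K p q n n')
    (1 + ∑ j ∈ Finset.range K, ∑ j' ∈ Finset.range K,
      p ^ j * q ^ j' * (normCoeff β n j * normCoeff β n' j')) ?_ ?_
  · simpa [sub_eq_zero] using h
  · intro l
    have h1 := groupMoment_le hβ0.le hβ1.le (hl l) K hp hq n n'
    have h2 := groupMoment_nonneg hβ0.le hβ1.le (hl l) K hp hq n n'
    have h3 := hM0 _ (hl l) n n'
    have h4 := hM1 _ (hl l) n n'
    rw [abs_le]
    constructor <;> linarith
  · intro l
    -- in the sums only the terms with `k = 0` survive, by induction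
    have hs : ∀ m m' : ℕ, m + m' = N + 1 → ∀ f : ℕ → ℝ, (∀ k < m, f k = 0) →
        ∑ kl ∈ Finset.HasAntidiagonal.antidiagonal m, (m.choose kl.1 : ℝ) *
          (stickMoment β (θ + l * β) kl.1 (kl.2 + m') * f kl.2) =
        stickMoment β (θ + l * β) 0 (N + 1) * f m := by
      intro m m' hm f hf
      rw [Finset.sum_eq_single (0, m)]
      · simp [hm]
      · rintro ⟨k, i⟩ hki hne
        have hki' : k + i = m := Finset.HasAntidiagonal.mem_antidiagonal.1 hki
        have : i < m := by
          rcases Nat.eq_zero_or_pos k with rfl | hk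
          · exact absurd (by simp_all) hne
          · omega
        simp [hf i this]
      · intro h
        exact absurd (Finset.HasAntidiagonal.mem_antidiagonal.2 (zero_add m)) h
    have hl' : θ + ((l + 1 : ℕ) : ℝ) * β = θ + l * β + β := by push_cast; ring
    have hpos' : 0 < θ + l * β + β := by have := hl l; linarith
    have e1 := hs n n' hN.symm (fun k => M (θ + l * β + β) k n' -
      groupMoment β (θ + l * β + β) K p q k n') fun k hk => by
        rw [ih (k + n') (by omega) hpos' (by omega) hn' rfl, sub_self]
    have e2 := hs n' n (by omega) (fun k => M (θ + l * β + β) n k -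
      groupMoment β (θ + l * β + β) K p q n k) fun k hk => by
        rw [ih (n + k) (by omega) hpos' hn (by omega) rfl, sub_self]
    simp only [mul_sub, Finset.sum_sub_distrib] at e1 e2
    have e3 := hrec _ (hl l) n n'
    have e4 := groupMoment_rec hβ0 (hl l) p q hn hn'
    rw [← hN] at e3 e4
    simp only [hl']
    linear_combination e3 - e4 + p * e1 + q * e2

/-! ### Independent sequences and their first term -/

/-- The sequence with first term `x` that continues with `s`. -/
def seqCons {X : Type*} (x : X) (s : ℕ → X) : ℕ → X
  | 0 => x
  | n + 1 => s n

section SeqCons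

variable {X Y : Type*} [MeasurableSpace X] [MeasurableSpace Y]

@[fun_prop]
theorem measurable_seqCons {f : Y → X} {g : Y → ℕ → X} (hf : Measurable f) (hg : Measurable g) :
    Measurable fun y => seqCons (f y) (g y) := by
  refine measurable_pi_iff.2 fun n => ?_
  rcases n with _ | n
  · exact hf
  · exact (measurable_pi_apply n).comp hg

theorem map_seqCons_infinitePi (μ : ℕ → Measure X) [∀ k, IsProbabilityMeasure (μ k)] :
    ((μ 0).prod (Measure.infinitePi fun k => μ (k + 1))).map (fun z => seqCons z.1 z.2) =
      Measure.infinitePi μ := by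
  refine Measure.eq_infinitePi μ fun s t ht => ?_
  classical
  obtain ⟨N, hN⟩ : ∃ N : ℕ, s ⊆ Finset.range (N + 1) := by
    obtain ⟨N, hN⟩ := s.exists_nat_subset_range
    exact ⟨N, hN.trans (Finset.range_mono N.le_succ)⟩
  set t' : ℕ → Set X := fun k => if k ∈ s then t k else Set.univ
  have ht' : ∀ k, MeasurableSet (t' k) := fun k => by
    by_cases h : k ∈ s <;> simp [t', h, ht]
  have hset : (fun z : X × (ℕ → X) => seqCons z.1 z.2) ⁻¹' Set.pi s t =
      t' 0 ×ˢ Set.pi (Finset.range N) fun k => t' (k + 1) := by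
    ext ⟨x, w⟩
    simp only [Set.mem_preimage, Set.mem_pi, Finset.mem_coe, Set.mem_prod, Finset.mem_range, t']
    constructor
    · intro h
      refine ⟨?_, fun k _ => ?_⟩
      · by_cases h0 : 0 ∈ s
        · simpa [h0, seqCons] using h 0 h0
        · simp [h0]
      · by_cases h0 : k + 1 ∈ s
        · simpa [h0, seqCons] using h (k + 1) h0
        · simp [h0]
    · rintro ⟨h1, h2⟩ k hk
      rcases k with _ | k
      · simpa [hk, seqCons] using h1
      · have hkN : k < N := by simpa using hN hk
        simpa [hk, seqCons] using h2 k hkN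
  rw [Measure.map_apply (by fun_prop) (.pi s.countable_toSet fun i _ => ht i), hset,
    Measure.prod_prod, Measure.infinitePi_pi _ (fun k _ => ht' (k + 1)), mul_comm,
    ← Finset.prod_range_succ' (fun k => μ k (t' k)), ← Finset.prod_subset hN]
  · exact Finset.prod_congr rfl fun k hk => by simp [t', hk]
  · intro k _ hk
    simp [t', hk]

theorem lintegral_infinitePi_seqCons (μ : ℕ → Measure X) [∀ k, IsProbabilityMeasure (μ k)]
    {F : (ℕ → X) → ℝ≥0∞} (hF : Measurable F) :
    ∫⁻ w, F w ∂Measure.infinitePi μ =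
      ∫⁻ x, ∫⁻ w, F (seqCons x w) ∂(Measure.infinitePi fun k => μ (k + 1)) ∂μ 0 := by
  rw [← map_seqCons_infinitePi, lintegral_map hF (by fun_prop), lintegral_prod _ (by fun_prop)]

end SeqCons

/-! ### The law of the sticks -/

theorem Gamma_add_nat {x : ℝ} (hx : 0 < x) (n : ℕ) :
    Real.Gamma (x + n) = rising x n * Real.Gamma x := by
  induction n with
  | zero => simp [rising_zero]
  | succ n ih =>
    rw [rising_succ, Nat.cast_succ, ← add_assoc, Real.Gamma_add_one (by positivity), ih]
    ring

theorem lintegral_betaMeasure_pow_mul_pow {p q : ℝ} (hp : 0 < p) (hq : 0 < q) (k l : ℕ) :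
    ∫⁻ x, ENNReal.ofReal x ^ k * ENNReal.ofReal (1 - x) ^ l ∂betaMeasure p q =
      ENNReal.ofReal (rising p k * rising q l / rising (p + q) (k + l)) := by
  have hpk : 0 < p + k := by positivity
  have hql : 0 < q + l := by positivity
  have hC : beta (p + k) (q + l) / beta p q =
      rising p k * rising q l / rising (p + q) (k + l) := by
    have h1 := (Real.Gamma_pos_of_pos hp).ne'
    have h2 := (Real.Gamma_pos_of_pos hq).ne'
    have h3 := (Real.Gamma_pos_of_pos (add_pos hp hq)).ne'
    have h4 := (rising_pos (add_pos hp hq) (k + l)).ne'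
    have h5 : p + k + (q + l) = p + q + ((k + l : ℕ) : ℝ) := by push_cast; ring
    rw [beta, beta, h5, Gamma_add_nat hp, Gamma_add_nat hq, Gamma_add_nat (add_pos hp hq)]
    field_simp
  have hb := (beta_pos hp hq).ne'
  have hb' := (beta_pos hpk hql).ne'
  have hC0 : 0 ≤ beta (p + k) (q + l) / beta p q :=
    div_nonneg (beta_pos hpk hql).le (beta_pos hp hq).le
  have hm : Measurable (betaPDF p q) := (measurable_betaPDFReal p q).ennreal_ofReal
  have hm' : Measurable (betaPDF (p + k) (q + l)) :=
    (measurable_betaPDFReal _ _).ennreal_ofReal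
  rw [betaMeasure, lintegral_withDensity_eq_lintegral_mul _ hm (by fun_prop), ← hC,
    ← mul_one (ENNReal.ofReal _), ← lintegral_betaPDF_eq_one hpk hql,
    ← lintegral_const_mul _ hm']
  refine lintegral_congr fun x => ?_
  simp only [Pi.mul_apply, betaPDF_eq]
  split_ifs with hx
  · have h1 : 0 < 1 - x := by linarith [hx.2]
    rw [← ENNReal.ofReal_pow hx.1.le, ← ENNReal.ofReal_pow h1.le,
      ← ENNReal.ofReal_mul (pow_nonneg hx.1.le _), ← ENNReal.ofReal_mul', ← ENNReal.ofReal_mul hC0]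
    · congr 1
      have e1 : x ^ (p + k - 1) = x ^ (p - 1) * x ^ k := by
        rw [← Real.rpow_add_natCast hx.1.ne']; congr 1; ring
      have e2 : (1 - x) ^ (q + l - 1) = (1 - x) ^ (q - 1) * (1 - x) ^ l := by
        rw [← Real.rpow_add_natCast h1.ne']; congr 1; ring
      rw [e1, e2]
      field_simp
    · exact mul_nonneg (pow_nonneg hx.1.le _) (pow_nonneg h1.le _)
  · simp

theorem ae_betaMeasure_mem_Ioo (p q : ℝ) : ∀ᵐ x ∂betaMeasure p q, x ∈ Set.Ioo (0 : ℝ) 1 := by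
  have hm : Measurable (betaPDF p q) := (measurable_betaPDFReal p q).ennreal_ofReal
  rw [betaMeasure, ae_withDensity_iff hm]
  refine Filter.Eventually.of_forall fun x hx => ?_
  by_contra h
  exact hx (by rw [betaPDF_eq, if_neg (show ¬(0 < x ∧ x < 1) from h), ENNReal.ofReal_zero])

open Classical in
/-- The law `Beta(1 - a, t + a)` of the first stick. For inadmissible parameters it is replaced by
a point mass, so that it is always a probability measure. -/
def stickBeta (a t : ℝ) : Measure ℝ :=
  if a < 1 ∧ 0 < t + a then betaMeasure (1 - a) (t + a) else Measure.dirac 0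

theorem stickBeta_eq {a t : ℝ} (ha : a < 1) (ht : 0 < t + a) :
    stickBeta a t = betaMeasure (1 - a) (t + a) :=
  if_pos ⟨ha, ht⟩

instance (a t : ℝ) : IsProbabilityMeasure (stickBeta a t) := by
  unfold stickBeta
  split_ifs with h
  · exact isProbabilityMeasureBeta (sub_pos.2 h.1) h.2
  · infer_instance

theorem lintegral_stickBeta {a t : ℝ} (ha : a < 1) (ht : 0 < t + a) (k l : ℕ) :
    ∫⁻ x, ENNReal.ofReal x ^ k * ENNReal.ofReal (1 - x) ^ l ∂stickBeta a t =
      ENNReal.ofReal (stickMoment a t k l) := by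
  rw [stickBeta_eq ha ht, lintegral_betaMeasure_pow_mul_pow (sub_pos.2 ha) ht, stickMoment]
  congr 3
  ring

theorem ae_stickBeta_mem_Icc (a t : ℝ) : ∀ᵐ x ∂stickBeta a t, x ∈ Set.Icc (0 : ℝ) 1 := by
  unfold stickBeta
  split_ifs with h
  · exact (ae_betaMeasure_mem_Ioo _ _).mono fun x hx => Set.Ioo_subset_Icc_self hx
  · exact (ae_dirac_iff (p := fun x => x ∈ Set.Icc (0 : ℝ) 1) measurableSet_Icc).2 (by simp)

/-- The law of the sequence of sticks with discount `a` and concentration `t`. -/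
def stickLaw (a t : ℝ) : Measure (ℕ → ℝ) :=
  Measure.infinitePi fun k : ℕ => stickBeta a (t + k * a)

instance (a t : ℝ) : IsProbabilityMeasure (stickLaw a t) := by
  unfold stickLaw; infer_instance

/-- Removing the first stick increases the concentration by the discount. -/
theorem lintegral_stickLaw (a t : ℝ) {F : (ℕ → ℝ) → ℝ≥0∞} (hF : Measurable F) :
    ∫⁻ u, F u ∂stickLaw a t =
      ∫⁻ x, ∫⁻ u, F (seqCons x u) ∂stickLaw a (t + a) ∂stickBeta a t := by
  have h : (fun k : ℕ => stickBeta a (t + ((k + 1 : ℕ) : ℝ) * a)) =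
      fun k : ℕ => stickBeta a (t + a + k * a) := by
    funext k
    congr 1
    push_cast
    ring
  rw [stickLaw, lintegral_infinitePi_seqCons _ hF, h]
  simp [stickLaw]

theorem ae_stickLaw_mem_Icc (a t : ℝ) : ∀ᵐ u ∂stickLaw a t, ∀ k, u k ∈ Set.Icc (0 : ℝ) 1 := by
  rw [ae_all_iff]
  intro k
  have h := ae_stickBeta_mem_Icc a (t + k * a)
  rw [← Measure.infinitePi_map_eval (fun k : ℕ => stickBeta a (t + k * a)) k] at h
  exact ae_of_ae_map (measurable_pi_apply k).aemeasurable h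

theorem IsSticks.map_eq {Ω : Type*} [MeasurableSpace Ω] {P : Measure Ω} [IsProbabilityMeasure P]
    {a t : ℝ} {U : ℕ → Ω → ℝ} (h : IsSticks P a t U) (ha0 : 0 ≤ a) (ha1 : a < 1) (ht : -a < t) :
    P.map (fun ω k => U k ω) = stickLaw a t := by
  rw [h.indep.map_fun_eq_infinitePi_map h.measurable, stickLaw]
  congr 1
  funext k
  have hk : 0 ≤ (k : ℝ) * a := by positivity
  rw [h.law k, stickBeta_eq ha1 (by linarith)]
  congr 1
  ring

/-! ### Stick-breaking weights -/

/-- The stick-breaking weights as extended nonnegative numbers. -/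
def weight (u : ℕ → ℝ) (k : ℕ) : ℝ≥0∞ :=
  ENNReal.ofReal (stick u k)

theorem measurable_stick (k : ℕ) : Measurable fun u => stick u k := by
  unfold stick; fun_prop

@[fun_prop]
theorem measurable_weight {Y : Type*} [MeasurableSpace Y] {f : Y → ℕ → ℝ} (hf : Measurable f)
    (k : ℕ) : Measurable fun y => weight (f y) k :=
  ((measurable_stick k).comp hf).ennreal_ofReal

theorem weight_seqCons_zero (x : ℝ) (u : ℕ → ℝ) : weight (seqCons x u) 0 = ENNReal.ofReal x := by
  simp [weight, stick, seqCons]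

theorem weight_seqCons_succ {x : ℝ} (hx : x ≤ 1) (u : ℕ → ℝ) (k : ℕ) :
    weight (seqCons x u) (k + 1) = ENNReal.ofReal (1 - x) * weight u k := by
  rw [weight, weight, ← ENNReal.ofReal_mul (sub_nonneg.2 hx)]
  congr 1
  simp only [stick, Finset.prod_range_succ', seqCons]
  ring

theorem stick_nonneg {u : ℕ → ℝ} (hu : ∀ k, u k ∈ Set.Icc (0 : ℝ) 1) (k : ℕ) : 0 ≤ stick u k :=
  mul_nonneg (hu k).1 (Finset.prod_nonneg fun l _ => sub_nonneg.2 (hu l).2)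

theorem sum_stick (u : ℕ → ℝ) (N : ℕ) :
    ∑ k ∈ Finset.range N, stick u k = 1 - ∏ l ∈ Finset.range N, (1 - u l) := by
  induction N with
  | zero => simp
  | succ N ih => rw [Finset.sum_range_succ, ih, Finset.prod_range_succ, stick]; ring

theorem tsum_weight_le_one {u : ℕ → ℝ} (hu : ∀ k, u k ∈ Set.Icc (0 : ℝ) 1) :
    ∑' k, weight u k ≤ 1 := by
  refine ENNReal.tsum_le_of_sum_range_le fun N => ?_
  rw [← ENNReal.ofReal_one]
  simp only [weight]
  rw [← ENNReal.ofReal_sum_of_nonneg fun k _ => stick_nonneg hu k, sum_stick]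
  refine ENNReal.ofReal_le_ofReal (sub_le_self _ (Finset.prod_nonneg fun l _ => ?_))
  exact sub_nonneg.2 (hu l).2

/-! ### Moments of the stick-breaking weights -/

/-- The power sum `∑_i V_i ^ J` of the weights. -/
def powerSum (J : ℕ) (u : ℕ → ℝ) : ℝ≥0∞ :=
  ∑' i, weight u i ^ J

open Classical in
/-- The sum `∑_{i ≠ i'} V_i ^ J * V_{i'} ^ K` over ordered pairs of distinct indices. -/
def pairSum (J K : ℕ) (u : ℕ → ℝ) : ℝ≥0∞ :=
  ∑' i, ∑' i', if i = i' then 0 else weight u i ^ J * weight u i' ^ K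

@[fun_prop]
theorem measurable_powerSum (J : ℕ) : Measurable (powerSum J) := by
  unfold powerSum
  exact .tsum fun i => by fun_prop

@[fun_prop]
theorem measurable_pairSum (J K : ℕ) : Measurable (pairSum J K) := by
  unfold pairSum
  refine .tsum fun i => .tsum fun i' => ?_
  split_ifs <;> fun_prop

theorem powerSum_seqCons {x : ℝ} (hx : x ≤ 1) (J : ℕ) (u : ℕ → ℝ) :
    powerSum J (seqCons x u) =
      ENNReal.ofReal x ^ J + ENNReal.ofReal (1 - x) ^ J * powerSum J u := by
  rw [powerSum, tsum_eq_zero_add' ENNReal.summable, powerSum, ← ENNReal.tsum_mul_left]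
  simp only [weight_seqCons_zero, weight_seqCons_succ hx, mul_pow]

theorem pairSum_seqCons {x : ℝ} (hx : x ≤ 1) (J K : ℕ) (u : ℕ → ℝ) :
    pairSum J K (seqCons x u) =
      ENNReal.ofReal x ^ J * ENNReal.ofReal (1 - x) ^ K * powerSum K u +
        ENNReal.ofReal x ^ K * ENNReal.ofReal (1 - x) ^ J * powerSum J u +
        ENNReal.ofReal (1 - x) ^ (J + K) * pairSum J K u := by
  classical
  have h1 : ∀ i : ℕ, (∑' i', if i + 1 = i' then 0 else
      weight (seqCons x u) (i + 1) ^ J * weight (seqCons x u) i' ^ K) =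
      ENNReal.ofReal x ^ K * ENNReal.ofReal (1 - x) ^ J * weight u i ^ J +
        ENNReal.ofReal (1 - x) ^ (J + K) *
          ∑' i', if i = i' then 0 else weight u i ^ J * weight u i' ^ K := by
    intro i
    rw [tsum_eq_zero_add' ENNReal.summable, ← ENNReal.tsum_mul_left]
    simp only [weight_seqCons_zero, weight_seqCons_succ hx, Nat.succ_ne_zero, if_false,
      Nat.add_right_cancel_iff, mul_ite, mul_zero]
    congr 1
    · ring
    · refine tsum_congr fun i' => ?_
      split_ifs
      · rfl
      · ring
  rw [pairSum, tsum_eq_zero_add' ENNReal.summable]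
  simp_rw [h1]
  rw [tsum_eq_zero_add' ENNReal.summable, ENNReal.tsum_add, ENNReal.tsum_mul_left,
    ENNReal.tsum_mul_left]
  simp only [if_true, weight_seqCons_zero, weight_seqCons_succ hx, zero_add,
    (Nat.succ_ne_zero _).symm, if_false, mul_pow, ← mul_assoc]
  rw [ENNReal.tsum_mul_left, powerSum, powerSum, pairSum, add_assoc]

theorem powerSum_succ_le_one {u : ℕ → ℝ} (hu : ∀ k, u k ∈ Set.Icc (0 : ℝ) 1) (J : ℕ) :
    powerSum (J + 1) u ≤ 1 := by
  have h := tsum_weight_le_one hu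
  refine le_trans (ENNReal.tsum_le_tsum fun i => ?_) h
  rw [pow_succ]
  exact mul_le_of_le_one_left' (pow_le_one' ((ENNReal.le_tsum i).trans h) J)

theorem pairSum_succ_le_one {u : ℕ → ℝ} (hu : ∀ k, u k ∈ Set.Icc (0 : ℝ) 1) (J K : ℕ) :
    pairSum (J + 1) (K + 1) u ≤ 1 := by
  classical
  calc pairSum (J + 1) (K + 1) u
      ≤ ∑' i, ∑' i', weight u i ^ (J + 1) * weight u i' ^ (K + 1) :=
        ENNReal.tsum_le_tsum fun i => ENNReal.tsum_le_tsum fun i' => by split_ifs <;> simp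
    _ = powerSum (J + 1) u * powerSum (K + 1) u := by
        simp_rw [ENNReal.tsum_mul_left, ENNReal.tsum_mul_right]
        rfl
    _ ≤ 1 := mul_le_one' (powerSum_succ_le_one hu J) (powerSum_succ_le_one hu K)

/-- A bounded function of the concentration is determined by the recursion that removes the first
stick. -/
theorem eq_ofReal_of_rec {a : ℝ} (ha0 : 0 < a) (ha1 : a < 1) (N : ℕ) (X : ℝ → ℝ≥0∞) (A Q : ℝ → ℝ)
    (C : ℝ) (hX : ∀ t, 0 < t → X t ≤ 1) (hQ0 : ∀ t, 0 < t → 0 ≤ Q t) (hQC : ∀ t, 0 < t → Q t ≤ C)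
    (hA : ∀ t, 0 < t → 0 ≤ A t)
    (hXrec : ∀ t, 0 < t → X t = ENNReal.ofReal (A t) +
      ENNReal.ofReal (stickMoment a t 0 (N + 1)) * X (t + a))
    (hQrec : ∀ t, 0 < t → Q t = A t + stickMoment a t 0 (N + 1) * Q (t + a))
    {t : ℝ} (ht : 0 < t) : X t = ENNReal.ofReal (Q t) := by
  have hl : ∀ l : ℕ, 0 < t + l * a := fun l => by positivity
  have hne : ∀ s, 0 < s → X s ≠ ⊤ := fun s hs => ne_top_of_le_ne_top ENNReal.one_ne_top (hX s hs)
  have h := eq_zero_of_rec ha0.le ha1 ht N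
    (fun l => (X (t + l * a)).toReal - Q (t + l * a)) (1 + C) ?_ ?_
  · simp only [Nat.cast_zero, zero_mul, add_zero, sub_eq_zero] at h
    rw [← h, ENNReal.ofReal_toReal (hne t ht)]
  · intro l
    have h1 : (X (t + l * a)).toReal ≤ 1 := by
      simpa using ENNReal.toReal_mono ENNReal.one_ne_top (hX _ (hl l))
    have h2 := hQ0 _ (hl l)
    have h3 := hQC _ (hl l)
    have h4 : 0 ≤ (X (t + l * a)).toReal := ENNReal.toReal_nonneg
    rw [abs_le]
    constructor <;> linarith
  · intro l
    have hl' : t + ((l + 1 : ℕ) : ℝ) * a = t + l * a + a := by push_cast; ring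
    have hpos : 0 < t + l * a + a := by have := hl l; linarith
    have hs := stickMoment_nonneg ha0.le ha1 (hl l) 0 (N + 1)
    simp only [hl']
    rw [hXrec _ (hl l), hQrec _ (hl l), ENNReal.toReal_add ENNReal.ofReal_ne_top
      (ENNReal.mul_ne_top ENNReal.ofReal_ne_top (hne _ hpos)), ENNReal.toReal_mul,
      ENNReal.toReal_ofReal (hA _ (hl l)), ENNReal.toReal_ofReal hs]
    ring

theorem one_le_rising {x : ℝ} (hx : 1 ≤ x) (n : ℕ) : 1 ≤ rising x n := by
  rw [rising, ← Finset.prod_const_one (s := Finset.range n)]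
  refine Finset.prod_le_prod (fun _ _ => zero_le_one) fun s _ => ?_
  have : (0 : ℝ) ≤ s := s.cast_nonneg
  linarith

theorem powerSumMoment_nonneg {a t : ℝ} (ha1 : a < 1) (ht : 0 < t) (J : ℕ) :
    0 ≤ powerSumMoment a t J :=
  div_nonneg (rising_pos (sub_pos.2 ha1) J).le (rising_pos (by linarith) J).le

theorem pairSumMoment_nonneg {a t : ℝ} (ha0 : 0 ≤ a) (ha1 : a < 1) (ht : 0 < t) (J K : ℕ) :
    0 ≤ pairSumMoment a t J K := by
  have h1 := rising_pos (sub_pos.2 ha1) J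
  have h2 := rising_pos (sub_pos.2 ha1) K
  have h3 := rising_pos (show 0 < t + 1 by linarith) (J + K + 1)
  unfold pairSumMoment
  positivity

theorem lintegral_powerSum {a t : ℝ} (ha0 : 0 < a) (ha1 : a < 1) (ht : 0 < t) (J : ℕ) :
    ∫⁻ u, powerSum (J + 1) u ∂stickLaw a t = ENNReal.ofReal (powerSumMoment a t J) := by
  refine eq_ofReal_of_rec ha0 ha1 J (fun t => ∫⁻ u, powerSum (J + 1) u ∂stickLaw a t)
    (fun t => stickMoment a t (J + 1) 0) (fun t => powerSumMoment a t J) 1 (fun t _ => ?_)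
    (fun t ht => powerSumMoment_nonneg ha1 ht J) (fun t ht => ?_)
    (fun t ht => stickMoment_nonneg ha0.le ha1 ht _ _) (fun t ht => ?_)
    (fun t ht => powerSumMoment_rec ha0 ht J) ht
  · calc _ ≤ ∫⁻ _, 1 ∂stickLaw a t := lintegral_mono_ae
          ((ae_stickLaw_mem_Icc a t).mono fun u hu => powerSum_succ_le_one hu J)
      _ = 1 := by simp
  · exact div_le_one_of_le₀ (rising_le_rising (by linarith) (by linarith) J)
      (rising_pos (by linarith) J).le
  · have hta : 0 < t + a := by linarith
    have h1 := lintegral_stickBeta ha1 hta (J + 1) 0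
    have h2 := lintegral_stickBeta ha1 hta 0 (J + 1)
    simp only [pow_zero, mul_one, one_mul] at h1 h2
    rw [lintegral_stickLaw _ _ (by fun_prop), ← h1, ← h2, ← lintegral_mul_const _ (by fun_prop),
      ← lintegral_add_left (by fun_prop)]
    refine lintegral_congr_ae ((ae_stickBeta_mem_Icc a t).mono fun x hx => ?_)
    simp only [powerSum_seqCons hx.2]
    rw [lintegral_add_left (by fun_prop), lintegral_const_mul _ (by fun_prop)]
    simp

theorem lintegral_pairSum {a t : ℝ} (ha0 : 0 < a) (ha1 : a < 1) (ht : 0 < t) (J K : ℕ) :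
    ∫⁻ u, pairSum (J + 1) (K + 1) u ∂stickLaw a t = ENNReal.ofReal (pairSumMoment a t J K) := by
  have hJ := rising_pos (sub_pos.2 ha1) J
  have hK := rising_pos (sub_pos.2 ha1) K
  refine eq_ofReal_of_rec ha0 ha1 (J + K + 1)
    (fun t => ∫⁻ u, pairSum (J + 1) (K + 1) u ∂stickLaw a t)
    (fun t => stickMoment a t (J + 1) (K + 1) * powerSumMoment a (t + a) K +
        stickMoment a t (K + 1) (J + 1) * powerSumMoment a (t + a) J)
    (fun t => pairSumMoment a t J K) (rising (1 - a) J * rising (1 - a) K) (fun t _ => ?_)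
    (fun t ht => pairSumMoment_nonneg ha0.le ha1 ht J K) (fun t ht => ?_)
    (fun t ht => ?_) (fun t ht => ?_) (fun t ht => pairSumMoment_rec ha0 ht J K) ht
  · calc _ ≤ ∫⁻ _, 1 ∂stickLaw a t := lintegral_mono_ae
          ((ae_stickLaw_mem_Icc a t).mono fun u hu => pairSum_succ_le_one hu J K)
      _ = 1 := by simp
  · have h1 : 1 ≤ rising (t + 1) (J + K) := one_le_rising (by linarith) _
    rw [pairSumMoment, div_le_iff₀ (rising_pos (by linarith) _), rising_succ, mul_assoc, mul_comm]
    refine mul_le_mul_of_nonneg_left ?_ (by positivity)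
    have h2 : (0 : ℝ) ≤ ((J + K : ℕ) : ℝ) := Nat.cast_nonneg _
    nlinarith
  · have h := stickMoment_nonneg ha0.le ha1 ht
    have h' := powerSumMoment_nonneg ha1 (show 0 < t + a by linarith)
    exact add_nonneg (mul_nonneg (h _ _) (h' _)) (mul_nonneg (h _ _) (h' _))
  · have hta : 0 < t + a := by linarith
    have hs := stickMoment_nonneg ha0.le ha1 ht
    have hp := powerSumMoment_nonneg ha1 hta
    have h3 := lintegral_stickBeta ha1 hta 0 (J + 1 + (K + 1))
    simp only [pow_zero, one_mul] at h3
    have e : J + K + 1 + 1 = J + 1 + (K + 1) := by ring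
    rw [ENNReal.ofReal_add (mul_nonneg (hs _ _) (hp _)) (mul_nonneg (hs _ _) (hp _)),
      ENNReal.ofReal_mul (hs _ _), ENNReal.ofReal_mul (hs _ _), e, ← h3,
      ← lintegral_stickBeta ha1 hta, ← lintegral_stickBeta ha1 hta,
      ← lintegral_powerSum ha0 ha1 hta, ← lintegral_powerSum ha0 ha1 hta,
      lintegral_stickLaw _ _ (by fun_prop), ← lintegral_mul_const _ (by fun_prop),
      ← lintegral_mul_const _ (by fun_prop), ← lintegral_mul_const _ (by fun_prop),
      ← lintegral_add_left (by fun_prop), ← lintegral_add_left (by fun_prop)]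
    refine lintegral_congr_ae ((ae_stickBeta_mem_Icc a t).mono fun x hx => ?_)
    simp only [pairSum_seqCons hx.2]
    rw [lintegral_add_left (by fun_prop), lintegral_add_left (by fun_prop),
      lintegral_const_mul _ (by fun_prop), lintegral_const_mul _ (by fun_prop),
      lintegral_const_mul _ (by fun_prop)]

/-! ### Moments of the masses of one group -/

open Classical in
/-- The mass `∑_{j : I_j = i} V_j` at `i`, for the weights `V` of the sticks `u`, as an extended
nonnegative number. -/
def massE (u : ℕ → ℝ) (I : ℕ → ℕ) (i : ℕ) : ℝ≥0∞ :=
  ∑' k, weight u k * if I k = i then 1 else 0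

@[fun_prop]
theorem measurable_massE {Y : Type*} [MeasurableSpace Y] {f : Y → ℕ → ℝ} {g : Y → ℕ → ℕ}
    (hf : Measurable f) (hg : Measurable g) (i : ℕ) :
    Measurable fun y => massE (f y) (g y) i := by
  classical
  unfold massE
  refine .tsum fun k => (measurable_weight hf k).mul ?_
  exact (Measurable.of_discrete (f := fun n : ℕ => if n = i then (1 : ℝ≥0∞) else 0)).comp
    ((measurable_pi_apply k).comp hg)

theorem mass_eq_toReal (u : ℕ → ℝ) (I : ℕ → ℕ) (i : ℕ) : mass u I i = (massE u I i).toReal := by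
  classical
  rw [mass, measureReal_def, stickMeasure, Measure.sum_apply _ (measurableSet_singleton i), massE]
  congr 2
  funext k
  simp [weight, Set.indicator_apply]

open Classical in
theorem massE_seqCons {x : ℝ} (hx : x ≤ 1) (u : ℕ → ℝ) (i₀ : ℕ) (I : ℕ → ℕ) (i : ℕ) :
    massE (seqCons x u) (seqCons i₀ I) i =
      ENNReal.ofReal x * (if i₀ = i then 1 else 0) + ENNReal.ofReal (1 - x) * massE u I i := by
  rw [massE, tsum_eq_zero_add' ENNReal.summable, massE, ← ENNReal.tsum_mul_left]
  simp only [weight_seqCons_zero, weight_seqCons_succ hx, mul_assoc]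
  rfl

theorem tsum_massE (u : ℕ → ℝ) (I : ℕ → ℕ) : ∑' i, massE u I i = ∑' k, weight u k := by
  classical
  unfold massE
  rw [ENNReal.tsum_comm]
  refine tsum_congr fun k => ?_
  rw [ENNReal.tsum_mul_left, tsum_eq_single (I k) fun i hi => if_neg hi.symm]
  simp

theorem massE_le_one {u : ℕ → ℝ} (hu : ∀ k, u k ∈ Set.Icc (0 : ℝ) 1) (I : ℕ → ℕ) (i : ℕ) :
    massE u I i ≤ 1 :=
  (ENNReal.le_tsum i).trans ((tsum_massE u I).trans_le (tsum_weight_le_one hu))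

/-- The joint law of the sticks and the labels of one group, when the labels have the law `η`. -/
def groupLaw (β θ : ℝ) (η : Measure ℕ) : Measure ((ℕ → ℝ) × (ℕ → ℕ)) :=
  (stickLaw β θ).prod (Measure.infinitePi fun _ => η)

instance (β θ : ℝ) (η : Measure ℕ) [IsProbabilityMeasure η] :
    IsProbabilityMeasure (groupLaw β θ η) := by
  unfold groupLaw; infer_instance

theorem lintegral_groupLaw (β θ : ℝ) (η : Measure ℕ) [IsProbabilityMeasure η]
    {F : (ℕ → ℝ) → (ℕ → ℕ) → ℝ≥0∞} (hF : Measurable (Function.uncurry F)) :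
    ∫⁻ w, F w.1 w.2 ∂groupLaw β θ η =
      ∫⁻ i₀, ∫⁻ x, ∫⁻ w, F (seqCons x w.1) (seqCons i₀ w.2) ∂groupLaw β (θ + β) η
        ∂stickBeta β θ ∂η := by
  have h1 : ∀ u, Measurable (F u) := fun u => hF.comp (by fun_prop : Measurable fun I => (u, I))
  have hF' : ∀ {Y : Type} [MeasurableSpace Y] {f : Y → ℕ → ℝ} {g : Y → ℕ → ℕ}, Measurable f →
      Measurable g → Measurable fun y => F (f y) (g y) := fun hf hg => hF.comp (hf.prodMk hg)
  unfold groupLaw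
  rw [lintegral_prod _ (hF' (by fun_prop) (by fun_prop)).aemeasurable]
  simp only
  have hm1 : Measurable fun u => ∫⁻ I, F u I ∂(Measure.infinitePi fun _ => η) :=
    Measurable.lintegral_prod_right' (f := fun z : (ℕ → ℝ) × (ℕ → ℕ) => F z.1 z.2)
      (hF' (by fun_prop) (by fun_prop))
  rw [lintegral_stickLaw _ _ hm1]
  have hm2 : ∀ x, Measurable fun z : (ℕ → ℝ) × ℕ =>
      ∫⁻ I, F (seqCons x z.1) (seqCons z.2 I) ∂(Measure.infinitePi fun _ => η) := fun x =>
    Measurable.lintegral_prod_right'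
      (f := fun z : ((ℕ → ℝ) × ℕ) × (ℕ → ℕ) => F (seqCons x z.1.1) (seqCons z.1.2 z.2))
      (hF' (by fun_prop) (by fun_prop))
  have hm3 : Measurable (Function.uncurry fun (i₀ : ℕ) (x : ℝ) =>
      ∫⁻ w, F (seqCons x w.1) (seqCons i₀ w.2)
        ∂((stickLaw β (θ + β)).prod (Measure.infinitePi fun _ => η))) :=
    Measurable.lintegral_prod_right'
      (f := fun z : (ℕ × ℝ) × ((ℕ → ℝ) × (ℕ → ℕ)) =>
        F (seqCons z.1.2 z.2.1) (seqCons z.1.1 z.2.2))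
      (hF' (by fun_prop) (by fun_prop))
  conv_rhs => rw [lintegral_lintegral_swap hm3.aemeasurable]
  refine lintegral_congr fun x => ?_
  simp_rw [fun u : ℕ → ℝ => lintegral_infinitePi_seqCons (fun _ : ℕ => η) (h1 (seqCons x u))]
  rw [lintegral_lintegral_swap (hm2 x).aemeasurable]
  refine lintegral_congr fun i₀ => ?_
  rw [lintegral_prod _ (hF' (by fun_prop) (by fun_prop)).aemeasurable]

/-- The moment `E[Z_i ^ n * Z_{i'} ^ n']` of the masses of one group whose labels have the law
`η`. -/
def massMoment (β : ℝ) (η : Measure ℕ) (i i' : ℕ) (θ : ℝ) (n n' : ℕ) : ℝ≥0∞ :=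
  ∫⁻ w, massE w.1 w.2 i ^ n * massE w.1 w.2 i' ^ n' ∂groupLaw β θ η

theorem ae_groupLaw_mem_Icc (β θ : ℝ) (η : Measure ℕ) [IsProbabilityMeasure η] :
    ∀ᵐ w ∂groupLaw β θ η, ∀ k, w.1 k ∈ Set.Icc (0 : ℝ) 1 :=
  (Measure.quasiMeasurePreserving_fst (μ := stickLaw β θ)).ae (ae_stickLaw_mem_Icc β θ)

theorem massMoment_le_one (β θ : ℝ) (η : Measure ℕ) [IsProbabilityMeasure η] (i i' n n' : ℕ) :
    massMoment β η i i' θ n n' ≤ 1 := by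
  calc massMoment β η i i' θ n n' ≤ ∫⁻ _, 1 ∂groupLaw β θ η :=
        lintegral_mono_ae ((ae_groupLaw_mem_Icc β θ η).mono fun w hw =>
          mul_le_one' (pow_le_one' (massE_le_one hw _ _) _) (pow_le_one' (massE_le_one hw _ _) _))
    _ = 1 := by simp

/-- The contribution of a first stick whose label is the first point. -/
theorem lintegral_first_label {β θ : ℝ} (hβ : β < 1) (hθ : 0 < θ + β) {W : Type*}
    [MeasurableSpace W] (ρ : Measure W) [SFinite ρ] {z z' : W → ℝ≥0∞} (hz : Measurable z)
    (hz' : Measurable z') (n n' : ℕ) :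
    ∫⁻ x, ∫⁻ w, (ENNReal.ofReal x + ENNReal.ofReal (1 - x) * z w) ^ n *
        (ENNReal.ofReal (1 - x) * z' w) ^ n' ∂ρ ∂stickBeta β θ =
      ∑ kl ∈ Finset.HasAntidiagonal.antidiagonal n, (n.choose kl.1 : ℝ≥0∞) *
        (ENNReal.ofReal (stickMoment β θ kl.1 (kl.2 + n')) * ∫⁻ w, z w ^ kl.2 * z' w ^ n' ∂ρ) := by
  have h1 : ∀ x w, (ENNReal.ofReal x + ENNReal.ofReal (1 - x) * z w) ^ n *
        (ENNReal.ofReal (1 - x) * z' w) ^ n' =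
      ∑ kl ∈ Finset.HasAntidiagonal.antidiagonal n, (n.choose kl.1 : ℝ≥0∞) *
        ((ENNReal.ofReal x ^ kl.1 * ENNReal.ofReal (1 - x) ^ (kl.2 + n')) *
          (z w ^ kl.2 * z' w ^ n')) := by
    intro x w
    rw [(Commute.all _ _).add_pow', Finset.sum_mul]
    refine Finset.sum_congr rfl fun kl _ => ?_
    rw [nsmul_eq_mul]
    ring
  simp_rw [h1]
  have h2 : ∀ x, ∫⁻ w, ∑ kl ∈ Finset.HasAntidiagonal.antidiagonal n, (n.choose kl.1 : ℝ≥0∞) *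
        ((ENNReal.ofReal x ^ kl.1 * ENNReal.ofReal (1 - x) ^ (kl.2 + n')) *
          (z w ^ kl.2 * z' w ^ n')) ∂ρ =
      ∑ kl ∈ Finset.HasAntidiagonal.antidiagonal n, (n.choose kl.1 : ℝ≥0∞) *
        ((ENNReal.ofReal x ^ kl.1 * ENNReal.ofReal (1 - x) ^ (kl.2 + n')) *
          ∫⁻ w, z w ^ kl.2 * z' w ^ n' ∂ρ) := by
    intro x
    rw [lintegral_finsetSum _ fun kl _ => by fun_prop]
    refine Finset.sum_congr rfl fun kl _ => ?_
    rw [lintegral_const_mul _ (by fun_prop), lintegral_const_mul _ (by fun_prop)]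
  simp_rw [h2]
  rw [lintegral_finsetSum _ fun kl _ => by fun_prop]
  refine Finset.sum_congr rfl fun kl _ => ?_
  rw [lintegral_const_mul _ (by fun_prop), lintegral_mul_const _ (by fun_prop),
    lintegral_stickBeta hβ hθ]

open Classical in
theorem lintegral_three_values (η : Measure ℕ) {i i' : ℕ} (hi : i ≠ i') (A B C : ℝ≥0∞) :
    ∫⁻ i₀, (if i₀ = i then A else if i₀ = i' then B else C) ∂η =
      η {i} * A + η {i'} * B + η {i, i'}ᶜ * C := by
  have h : ∀ i₀ : ℕ, (if i₀ = i then A else if i₀ = i' then B else C) =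
      ({i} : Set ℕ).indicator (fun _ => A) i₀ + ({i'} : Set ℕ).indicator (fun _ => B) i₀ +
        ({i, i'}ᶜ : Set ℕ).indicator (fun _ => C) i₀ := by
    intro i₀
    by_cases h1 : i₀ = i
    · subst h1; simp [hi]
    · by_cases h2 : i₀ = i'
      · subst h2; simp [h1]
      · simp [h1, h2]
  simp_rw [h]
  rw [lintegral_add_left (by fun_prop), lintegral_add_left (by fun_prop),
    lintegral_indicator_const (by simp), lintegral_indicator_const (by simp),
    lintegral_indicator_const (by measurability)]
  ring

theorem massMoment_rec {β θ : ℝ} (hβ1 : β < 1) (hθ : 0 < θ + β) (η : Measure ℕ)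
    [IsProbabilityMeasure η] {i i' : ℕ} (hi : i ≠ i') (n n' : ℕ) :
    massMoment β η i i' θ n n' =
      η {i} * ∑ kl ∈ Finset.HasAntidiagonal.antidiagonal n, (n.choose kl.1 : ℝ≥0∞) *
          (ENNReal.ofReal (stickMoment β θ kl.1 (kl.2 + n')) *
            massMoment β η i i' (θ + β) kl.2 n') +
        η {i'} * ∑ kl ∈ Finset.HasAntidiagonal.antidiagonal n', (n'.choose kl.1 : ℝ≥0∞) *
          (ENNReal.ofReal (stickMoment β θ kl.1 (kl.2 + n)) *
            massMoment β η i i' (θ + β) n kl.2) +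
        η {i, i'}ᶜ * (ENNReal.ofReal (stickMoment β θ 0 (n + n')) *
          massMoment β η i i' (θ + β) n n') := by
  classical
  have hm : ∀ j : ℕ, Measurable fun w : (ℕ → ℝ) × (ℕ → ℕ) => massE w.1 w.2 j := fun j => by fun_prop
  rw [massMoment, lintegral_groupLaw β θ η
    (F := fun u I => massE u I i ^ n * massE u I i' ^ n') (by
      have h1 := hm i
      have h2 := hm i'
      exact (h1.pow_const n).mul (h2.pow_const n'))]
  have hA := lintegral_first_label hβ1 hθ (groupLaw β (θ + β) η) (hm i) (hm i') n n'
  have hB := lintegral_first_label hβ1 hθ (groupLaw β (θ + β) η) (hm i') (hm i) n' n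
  have hC : ∫⁻ x, ∫⁻ w, (ENNReal.ofReal (1 - x) * massE w.1 w.2 i) ^ n *
      (ENNReal.ofReal (1 - x) * massE w.1 w.2 i') ^ n' ∂groupLaw β (θ + β) η ∂stickBeta β θ =
      ENNReal.ofReal (stickMoment β θ 0 (n + n')) * massMoment β η i i' (θ + β) n n' := by
    rw [← lintegral_stickBeta hβ1 hθ, ← lintegral_mul_const _ (by fun_prop)]
    refine lintegral_congr fun x => ?_
    rw [massMoment, ← lintegral_const_mul _ (by fun_prop)]
    refine lintegral_congr fun w => ?_
    ring
  have hsw : ∀ k : ℕ, ∫⁻ w, massE w.1 w.2 i' ^ k * massE w.1 w.2 i ^ n ∂groupLaw β (θ + β) η =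
      massMoment β η i i' (θ + β) n k := fun k => lintegral_congr fun w => mul_comm _ _
  simp_rw [hsw] at hB
  change _ = ∑ kl ∈ Finset.HasAntidiagonal.antidiagonal n, (n.choose kl.1 : ℝ≥0∞) *
    (ENNReal.ofReal (stickMoment β θ kl.1 (kl.2 + n')) *
      massMoment β η i i' (θ + β) kl.2 n') at hA
  rw [← hA, ← hB, ← hC, ← lintegral_three_values η hi]
  refine lintegral_congr fun i₀ => ?_
  have hx : ∀ f g : ℝ → ℝ≥0∞, (∀ x, x ≤ 1 → f x = g x) →
      ∫⁻ x, f x ∂stickBeta β θ = ∫⁻ x, g x ∂stickBeta β θ := fun f g h =>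
    lintegral_congr_ae ((ae_stickBeta_mem_Icc β θ).mono fun x hx => h x hx.2)
  split_ifs with h1 h2
  · refine hx _ _ fun x hx => lintegral_congr fun w => ?_
    rw [massE_seqCons hx, massE_seqCons hx, if_pos h1, if_neg (h1 ▸ hi), mul_one, mul_zero,
      zero_add]
  · refine hx _ _ fun x hx => lintegral_congr fun w => ?_
    rw [massE_seqCons hx, massE_seqCons hx, if_pos h2, if_neg h1, mul_one, mul_zero,
      zero_add, mul_comm]
  · refine hx _ _ fun x hx => lintegral_congr fun w => ?_
    rw [massE_seqCons hx, massE_seqCons hx, if_neg h1, if_neg h2, mul_zero, zero_add, zero_add]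

/-- The mixed moments of the masses of one group at two distinct points. -/
theorem massMoment_eq {β θ : ℝ} (hβ0 : 0 < β) (hβ1 : β < 1) (hθ : 0 < θ) (η : Measure ℕ)
    [IsProbabilityMeasure η] {i i' : ℕ} (hi : i ≠ i') {K n n' : ℕ} (hn : n < K) (hn' : n' < K) :
    massMoment β η i i' θ n n' =
      ENNReal.ofReal (groupMoment β θ K (η.real {i}) (η.real {i'}) n n') := by
  have hne : ∀ θ n n', massMoment β η i i' θ n n' ≠ ⊤ := fun θ n n' =>
    ne_top_of_le_ne_top ENNReal.one_ne_top (massMoment_le_one β θ η i i' n n')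
  rw [← eq_groupMoment_of_rec hβ0 hβ1 K measureReal_nonneg measureReal_nonneg
    (fun θ n n' => (massMoment β η i i' θ n n').toReal) (fun _ _ _ _ => ENNReal.toReal_nonneg)
    (fun θ _ n n' => ?_) (fun θ _ => ?_) (fun θ hθ n n' => ?_) hθ hn hn',
    ENNReal.ofReal_toReal (hne _ _ _)]
  · simpa using ENNReal.toReal_mono ENNReal.one_ne_top (massMoment_le_one β θ η i i' n n')
  · simp [massMoment]
  · have hs := stickMoment_nonneg hβ0.le hβ1 hθ
    have hc : (η {i, i'}ᶜ).toReal = 1 - η.real {i} - η.real {i'} := by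
      have h1 : η.real ({i, i'} : Set ℕ) = η.real {i} + η.real {i'} := by
        rw [Set.insert_eq, measureReal_union (by simpa using hi) (by simp)]
      rw [← measureReal_def, probReal_compl_eq_one_sub (by measurability), h1]
      ring
    have hf : ∀ (k l m m' : ℕ), ENNReal.ofReal (stickMoment β θ k l) *
        massMoment β η i i' (θ + β) m m' ≠ ⊤ := fun k l m m' =>
      ENNReal.mul_ne_top ENNReal.ofReal_ne_top (hne _ _ _)
    have hf' : ∀ (c k l m m' : ℕ), (c : ℝ≥0∞) * (ENNReal.ofReal (stickMoment β θ k l) *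
        massMoment β η i i' (θ + β) m m') ≠ ⊤ := fun c k l m m' =>
      ENNReal.mul_ne_top (ENNReal.natCast_ne_top c) (hf k l m m')
    rw [massMoment_rec hβ1 (by linarith) η hi, ENNReal.toReal_add, ENNReal.toReal_add,
      ENNReal.toReal_mul, ENNReal.toReal_mul, ENNReal.toReal_mul, ENNReal.toReal_mul, hc,
      ENNReal.toReal_sum fun _ _ => hf' _ _ _ _ _, ENNReal.toReal_sum fun _ _ => hf' _ _ _ _ _]
    · simp only [ENNReal.toReal_mul, ENNReal.toReal_natCast, ENNReal.toReal_ofReal (hs _ _),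
        measureReal_def]
    · exact ENNReal.mul_ne_top (measure_ne_top _ _) (ENNReal.sum_ne_top.2 fun _ _ => hf' _ _ _ _ _)
    · exact ENNReal.mul_ne_top (measure_ne_top _ _) (ENNReal.sum_ne_top.2 fun _ _ => hf' _ _ _ _ _)
    · exact ENNReal.add_ne_top.2 ⟨ENNReal.mul_ne_top (measure_ne_top _ _)
        (ENNReal.sum_ne_top.2 fun _ _ => hf' _ _ _ _ _), ENNReal.mul_ne_top (measure_ne_top _ _)
        (ENNReal.sum_ne_top.2 fun _ _ => hf' _ _ _ _ _)⟩
    · exact ENNReal.mul_ne_top (measure_ne_top _ _) (hf _ _ _ _)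

/-! ### The law of the labels -/

open Classical in
/-- The law of a label given the sticks `u` of level one: the label is `k` with probability
`stick u k`. When the weights do not sum to one, which has probability zero, it is replaced by a
point mass, so that it is always a probability measure. -/
def labelLaw (u : ℕ → ℝ) : Measure ℕ :=
  if ∑' k, weight u k = 1 then Measure.sum fun k => weight u k • Measure.dirac k
  else Measure.dirac 0

theorem labelLaw_singleton {u : ℕ → ℝ} (hu : ∑' k, weight u k = 1) (i : ℕ) :
    labelLaw u {i} = weight u i := by
  rw [labelLaw, if_pos hu, Measure.sum_smul_dirac_singleton]

instance (u : ℕ → ℝ) : IsProbabilityMeasure (labelLaw u) := by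
  unfold labelLaw
  split_ifs with h
  · exact ⟨by simpa using h⟩
  · infer_instance

theorem measurable_labelLaw : Measurable labelLaw := by
  refine Measure.measurable_of_measurable_coe _ fun s hs => ?_
  have h : (fun u => labelLaw u s) = fun u => if ∑' k, weight u k = 1 then
      ∑' k, weight u k * Measure.dirac k s else Measure.dirac 0 s := by
    funext u
    unfold labelLaw
    split_ifs
    · rw [Measure.sum_apply _ hs]; rfl
    · rfl
  rw [h]
  refine Measurable.ite ?_ ?_ measurable_const
  · exact measurableSet_eq_fun (.tsum fun k => by fun_prop) measurable_const
  · exact .tsum fun k => by fun_prop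

/-- The law of independent labels, indexed by `ι`, given the sticks of level one. -/
def labelKernel (ι : Type*) : Kernel (ℕ → ℝ) (ι → ℕ) where
  toFun u := Measure.infinitePi fun _ => labelLaw u
  measurable' := by
    refine Measurable.measure_of_isPiSystem_of_isProbabilityMeasure
      (S := squareCylinders fun _ => {s : Set ℕ | MeasurableSet s})
      generateFrom_squareCylinders.symm
      (isPiSystem_squareCylinders (fun _ => MeasurableSpace.isPiSystem_measurableSet)
        (by simp)) ?_
    rintro _ ⟨s, t, ht, rfl⟩
    have ht' : ∀ i, MeasurableSet (t i) := fun i => ht i (Set.mem_univ i)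
    simp_rw [Measure.infinitePi_pi _ fun i _ => ht' i]
    exact Finset.measurable_prod _ fun i _ =>
      (Measure.measurable_coe (ht' i)).comp measurable_labelLaw

theorem labelKernel_apply (ι : Type*) (u : ℕ → ℝ) :
    labelKernel ι u = Measure.infinitePi fun _ => labelLaw u := rfl

instance (ι : Type*) : IsMarkovKernel (labelKernel ι) :=
  ⟨fun u => by rw [labelKernel_apply]; infer_instance⟩

section Transfer

variable {Ω S : Type*} [MeasurableSpace Ω] [MeasurableSpace S] {P : Measure Ω}
  {α θ₀ β θ : ℝ} {ν : Measure S} {L : ℕ} {U : ℕ → Ω → ℝ} {ξ : ℕ → Ω → S}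
  {U' : Fin L → ℕ → Ω → ℝ} {I : Fin L → ℕ → Ω → ℕ}

theorem IsHierarchical.map_sticks [IsProbabilityMeasure P]
    (h : IsHierarchical P α θ₀ β θ ν L U ξ U' I)
    (hα : α ∈ Set.Ioo (0 : ℝ) 1) (hβ : β ∈ Set.Ioo (0 : ℝ) 1) (hθ₀ : -α < θ₀) (hθ : -β < θ) :
    P.map (fun ω => ((fun k => U k ω, fun g k => U' g k ω) : (ℕ → ℝ) × (Fin L → ℕ → ℝ))) =
      (stickLaw α θ₀).prod (Measure.pi fun _ => stickLaw β θ) := by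
  have hU : ∀ k, Measurable (U k) := h.level_one.sticks.measurable
  have hU' : ∀ g k, Measurable (U' g k) := fun g => (h.sticks g).measurable
  have hi : IndepFun (fun ω k => U k ω) (fun ω (g : Fin L) (k : ℕ) => U' g k ω) P :=
    h.indep_levels.comp measurable_fst measurable_id
  have h1 := h.indep_groups.map_fun_eq_pi_map fun g =>
    (measurable_pi_iff.2 fun k => hU' g k).aemeasurable
  rw [hi.map_prod_eq_prod_map_map (by fun_prop) (by fun_prop), h1,
    h.level_one.sticks.map_eq hα.1.le hα.2 hθ₀]
  congr 2
  funext g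
  exact (h.sticks g).map_eq hβ.1.le hβ.2 hθ

/-- `law_label` without the atoms of level one. -/
theorem IsHierarchical.measure_label (h : IsHierarchical P α θ₀ β θ ν L U ξ U' I)
    {B : Set ((ℕ → ℝ) × (Fin L → ℕ → ℝ))} (hB : MeasurableSet B) (F : Finset (Fin L × ℕ))
    (i : Fin L × ℕ → ℕ) :
    P ({ω | (fun k => U k ω, fun g k => U' g k ω) ∈ B} ∩ {ω | ∀ p ∈ F, I p.1 p.2 ω = i p}) =
      ∫⁻ ω in {ω | (fun k => U k ω, fun g k => U' g k ω) ∈ B},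
        ∏ p ∈ F, weight (fun k => U k ω) (i p) ∂P :=
  h.law_label ((fun z => (z.1.1, z.2)) ⁻¹' B)
    ((by fun_prop : Measurable fun z : ((ℕ → ℝ) × (ℕ → S)) × (Fin L → ℕ → ℝ) => (z.1.1, z.2)) hB)
    F i

/-- The level one weights sum to one almost surely, because the labels have a law. -/
theorem IsHierarchical.ae_tsum_weight [IsProbabilityMeasure P]
    (h : IsHierarchical P α θ₀ β θ ν L U ξ U' I)
    (hα : α ∈ Set.Ioo (0 : ℝ) 1) (hθ₀ : -α < θ₀) (hL : 1 ≤ L) :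
    ∀ᵐ u ∂stickLaw α θ₀, ∑' k, weight u k = 1 := by
  have hU : ∀ k, Measurable (U k) := h.level_one.sticks.measurable
  let p : Fin L × ℕ := (⟨0, hL⟩, 0)
  have h1 : ∀ i : ℕ, P {ω | I p.1 p.2 ω = i} = ∫⁻ u, weight u i ∂stickLaw α θ₀ := by
    intro i
    have h2 := h.measure_label MeasurableSet.univ {p} fun _ => i
    rw [← h.level_one.sticks.map_eq hα.1.le hα.2 hθ₀, lintegral_map (by fun_prop) (by fun_prop)]
    simpa using h2
  have h3 : ∫⁻ u, ∑' k, weight u k ∂stickLaw α θ₀ = 1 := by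
    rw [lintegral_tsum fun k => by fun_prop]
    simp_rw [← h1]
    rw [← measure_iUnion]
    · rw [← measure_univ (μ := P)]
      congr 1
      ext ω
      simp
    · intro i j hij
      refine Set.disjoint_left.2 fun ω h1 h2 => hij ?_
      exact Eq.trans (Eq.symm h1) h2
    · intro i
      exact h.measurable_label _ _ (measurableSet_singleton i)
  refine ae_eq_of_ae_le_of_lintegral_le (g := fun _ => 1) ?_ ?_ (by fun_prop) ?_
  · exact (ae_stickLaw_mem_Icc α θ₀).mono fun u hu => tsum_weight_le_one hu
  · rw [h3]; exact ENNReal.one_ne_top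
  · rw [h3]; simp

/-- The joint law of the sticks of both levels and the labels. -/
theorem IsHierarchical.map_eq [IsProbabilityMeasure P]
    (h : IsHierarchical P α θ₀ β θ ν L U ξ U' I)
    (hα : α ∈ Set.Ioo (0 : ℝ) 1) (hβ : β ∈ Set.Ioo (0 : ℝ) 1) (hθ₀ : -α < θ₀) (hθ : -β < θ)
    (hL : 1 ≤ L) :
    P.map (fun ω => (((fun k => U k ω, fun g k => U' g k ω), fun p => I p.1 p.2 ω) :
        ((ℕ → ℝ) × (Fin L → ℕ → ℝ)) × (Fin L × ℕ → ℕ))) =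
      ((stickLaw α θ₀).prod (Measure.pi fun _ => stickLaw β θ)) ⊗ₘ
        (labelKernel (Fin L × ℕ)).comap Prod.fst measurable_fst := by
  have hU : ∀ k, Measurable (U k) := h.level_one.sticks.measurable
  have hU' : ∀ g k, Measurable (U' g k) := fun g => (h.sticks g).measurable
  have hI := h.measurable_label
  set X : Ω → (ℕ → ℝ) × (Fin L → ℕ → ℝ) := fun ω => (fun k => U k ω, fun g k => U' g k ω)
    with hX
  have hXm : Measurable X := by fun_prop
  set J : Ω → Fin L × ℕ → ℕ := fun ω p => I p.1 p.2 ω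
  have hJm : Measurable J := by fun_prop
  set μ := (stickLaw α θ₀).prod (Measure.pi fun _ : Fin L => stickLaw β θ)
  have hμ : P.map X = μ := h.map_sticks hα hβ hθ₀ hθ
  set κ := (labelKernel (Fin L × ℕ)).comap (Prod.fst : (ℕ → ℝ) × (Fin L → ℕ → ℝ) → _)
    measurable_fst
  have : IsProbabilityMeasure (P.map fun ω => (X ω, J ω)) :=
    Measure.isProbabilityMeasure_map (by fun_prop)
  refine Measure.ext_prod fun {B s} hB hs => ?_
  rw [Measure.compProd_apply_prod hB hs, Measure.map_apply (by fun_prop) (hB.prod hs)]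
  have hκ : ∀ s, MeasurableSet s → ((μ.restrict B).bind κ) s = ∫⁻ x in B, κ x s ∂μ := fun s hs =>
    Measure.bind_apply hs κ.measurable.aemeasurable
  have hfin : ((P.restrict (X ⁻¹' B)).map J) = (μ.restrict B).bind κ := by
    have : IsFiniteMeasure ((μ.restrict B).bind κ) := ⟨by
      rw [hκ _ MeasurableSet.univ]; simp⟩
    refine IsProjectiveLimit.unique (P := fun F : Finset (Fin L × ℕ) =>
      ((μ.restrict B).bind κ).map F.restrict) (fun F => ?_) (fun F => rfl)
    refine Measure.ext_of_singleton fun a => ?_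
    classical
    let i : Fin L × ℕ → ℕ := fun p => if hp : p ∈ F then a ⟨p, hp⟩ else 0
    have hset : (F.restrict (π := fun _ : Fin L × ℕ => ℕ)) ⁻¹' {a} =
        Set.pi F fun p => {i p} := by
      ext f
      simp only [Set.mem_preimage, Set.mem_singleton_iff, Set.mem_pi, Finset.mem_coe, i]
      constructor
      · rintro rfl p hp
        simp [hp]
      · intro hf
        funext p
        simpa using hf p.1 p.2
    have hms : MeasurableSet (Set.pi (F : Set (Fin L × ℕ)) fun p => ({i p} : Set ℕ)) :=
      .pi F.countable_toSet fun _ _ => measurableSet_singleton _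
    rw [Measure.map_apply (by fun_prop) (measurableSet_singleton a),
      Measure.map_apply (by fun_prop) (measurableSet_singleton a), hset,
      Measure.map_apply hJm hms, Measure.restrict_apply (hJm hms), hκ _ hms, Set.inter_comm]
    have hl := h.measure_label hB F i
    have hJs : J ⁻¹' (Set.pi F fun p => {i p}) = {ω | ∀ p ∈ F, I p.1 p.2 ω = i p} := by
      ext ω; simp [J]
    rw [hJs]
    refine hl.trans ?_
    have h1 : ∀ᵐ x ∂μ, κ x (Set.pi F fun p => {i p}) = ∏ p ∈ F, weight x.1 (i p) := by
      refine ((Measure.quasiMeasurePreserving_fst (μ := stickLaw α θ₀)).ae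
        (h.ae_tsum_weight hα hθ₀ hL)).mono fun x hx => ?_
      rw [Kernel.comap_apply, labelKernel_apply,
        Measure.infinitePi_pi _ fun _ _ => measurableSet_singleton _]
      exact Finset.prod_congr rfl fun p _ => labelLaw_singleton hx _
    rw [lintegral_congr_ae (ae_restrict_of_ae h1), ← hμ,
      setLIntegral_map hB (Finset.measurable_prod _ fun p _ => by fun_prop) hXm]
    rfl
  rw [← hκ s hs, ← hfin, Measure.map_apply hJm hs, Measure.restrict_apply (hJm hs), Set.inter_comm]
  rfl

theorem IsHierarchical.lintegral_eq [IsProbabilityMeasure P]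
    (h : IsHierarchical P α θ₀ β θ ν L U ξ U' I)
    (hα : α ∈ Set.Ioo (0 : ℝ) 1) (hβ : β ∈ Set.Ioo (0 : ℝ) 1) (hθ₀ : -α < θ₀) (hθ : -β < θ)
    (hL : 1 ≤ L) {F : ((ℕ → ℝ) × (Fin L → ℕ → ℝ)) × (Fin L × ℕ → ℕ) → ℝ≥0∞} (hF : Measurable F) :
    ∫⁻ ω, F ((fun k => U k ω, fun g k => U' g k ω), fun p => I p.1 p.2 ω) ∂P =
      ∫⁻ u, ∫⁻ y, ∫⁻ J, F ((u, y), J) ∂(Measure.infinitePi fun _ => labelLaw u)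
        ∂(Measure.pi fun _ => stickLaw β θ) ∂stickLaw α θ₀ := by
  have hU : ∀ k, Measurable (U k) := h.level_one.sticks.measurable
  have hU' : ∀ g k, Measurable (U' g k) := fun g => (h.sticks g).measurable
  have hI := h.measurable_label
  have h1 := lintegral_map (μ := P) hF (g := fun ω => (((fun k => U k ω, fun g k => U' g k ω),
    fun p => I p.1 p.2 ω) : ((ℕ → ℝ) × (Fin L → ℕ → ℝ)) × (Fin L × ℕ → ℕ))) (by fun_prop)
  rw [← h1, h.map_eq hα hβ hθ₀ hθ hL, Measure.lintegral_compProd hF, lintegral_prod]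
  · rfl
  · exact (Measurable.lintegral_kernel_prod_right' hF).aemeasurable

end Transfer

/-! ### Independence of the groups -/

theorem lintegral_pi_prod {ι : Type*} [Fintype ι] {X : ι → Type*} [∀ i, MeasurableSpace (X i)]
    (μ : ∀ i, Measure (X i)) [∀ i, IsProbabilityMeasure (μ i)] {f : ∀ i, X i → ℝ≥0∞}
    (hf : ∀ i, Measurable (f i)) :
    ∫⁻ w, ∏ i, f i (w i) ∂Measure.pi μ = ∏ i, ∫⁻ x, f i x ∂μ i := by
  refine (lintegral_prod_eq_prod_lintegral_of_indepFun Finset.univ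
    (fun i (w : ∀ i, X i) => f i (w i)) (iIndepFun_pi fun i => (hf i).aemeasurable)
    fun i => (hf i).comp (measurable_pi_apply i)).trans ?_
  refine Finset.prod_congr rfl fun i _ => ?_
  exact (measurePreserving_eval μ i).lintegral_comp (hf i)

theorem lintegral_groups {L : ℕ} (β θ : ℝ) (η : Measure ℕ) [IsProbabilityMeasure η]
    {F : Fin L → (ℕ → ℝ) × (ℕ → ℕ) → ℝ≥0∞} (hF : ∀ g, Measurable (F g)) :
    ∫⁻ y, ∫⁻ J, ∏ g, F g (y g, fun k => J (g, k)) ∂(Measure.infinitePi fun _ : Fin L × ℕ => η)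
        ∂(Measure.pi fun _ : Fin L => stickLaw β θ) =
      ∏ g, ∫⁻ w, F g w ∂groupLaw β θ η := by
  have h1 : ∀ y : Fin L → ℕ → ℝ, ∫⁻ J, ∏ g, F g (y g, fun k => J (g, k))
      ∂(Measure.infinitePi fun _ : Fin L × ℕ => η) =
      ∏ g, ∫⁻ I, F g (y g, I) ∂(Measure.infinitePi fun _ : ℕ => η) := by
    intro y
    rw [← lintegral_pi_prod (fun _ : Fin L => Measure.infinitePi fun _ : ℕ => η)
      (f := fun g I => F g (y g, I))
      (fun g => (hF g).comp (measurable_const.prodMk measurable_id)), ← Measure.infinitePi_eq_pi,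
      ← Measure.infinitePi_map_curry (fun _ _ => η), lintegral_map _ (MeasurableEquiv.measurable _)]
    · rfl
    · exact Finset.measurable_prod _ fun g _ =>
        (hF g).comp (measurable_const.prodMk (measurable_pi_apply g))
  simp_rw [h1]
  rw [lintegral_pi_prod (fun _ => stickLaw β θ)
    (f := fun g u => ∫⁻ I, F g (u, I) ∂(Measure.infinitePi fun _ : ℕ => η))
    fun g => (hF g).lintegral_prod_right']
  exact Finset.prod_congr rfl fun g _ => (lintegral_prod _ (hF g).aemeasurable).symm

/-! ### Expectations of sums over the atoms -/

/-- The expectation of `∑_i ∏_g Z_{g,i} ^ n_g`, for `n ≠ 0`. If `∑ s_g = 0`, then the truncated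
subtraction is irrelevant, as the coefficient in front of it vanishes. Any `K > max n_g` gives the
same value. -/
def atomMean (α θ₀ β θ : ℝ) (K : ℕ) {L : ℕ} (n : Fin L → ℕ) : ℝ :=
  ∑ s ∈ Fintype.piFinset fun _ : Fin L => Finset.range K,
    (∏ g, (blockFactor β θ (s g) (n g) * normCoeff β (n g) (s g))) *
      powerSumMoment α θ₀ (∑ g, s g - 1)

/-- The expectation of `∑_{i ≠ i'} ∏_g Z_{g,i} ^ n_g * Z_{g,i'} ^ n'_g`, with the same conventions
as in `atomMean`. -/
def atomPairMean (α θ₀ β θ : ℝ) (K : ℕ) {L : ℕ} (n n' : Fin L → ℕ) : ℝ :=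
  ∑ s ∈ Fintype.piFinset fun _ : Fin L => Finset.range K,
    ∑ s' ∈ Fintype.piFinset fun _ : Fin L => Finset.range K,
      (∏ g, (blockFactor β θ (s g + s' g) (n g + n' g) *
        (normCoeff β (n g) (s g) * normCoeff β (n' g) (s' g)))) *
      pairSumMoment α θ₀ (∑ g, s g - 1) (∑ g, s' g - 1)

theorem groupMoment_zero_right (β θ : ℝ) {K : ℕ} (hK : 0 < K) (p q : ℝ) (n : ℕ) :
    groupMoment β θ K p q n 0 =
      ∑ j ∈ Finset.range K, p ^ j * (blockFactor β θ j n * normCoeff β n j) := by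
  refine Finset.sum_congr rfl fun j _ => ?_
  rw [Finset.sum_eq_single_of_mem 0 (Finset.mem_range.2 hK)]
  · simp [normCoeff, genFactCoeff_zero_zero]
  · intro j' _ hj'
    rw [normCoeff_eq_zero β (Nat.pos_of_ne_zero hj')]
    ring

theorem prod_normCoeff_eq_zero {β : ℝ} {L : ℕ} {n s : Fin L → ℕ} (hn : ∑ g, n g ≠ 0)
    (hs : ∑ g, s g = 0) : ∃ g, normCoeff β (n g) (s g) = 0 := by
  obtain ⟨g, _, hg⟩ := Finset.exists_ne_zero_of_sum_ne_zero hn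
  have h0 : s g = 0 := Finset.sum_eq_zero_iff.1 hs g (Finset.mem_univ g)
  exact ⟨g, by rw [h0, normCoeff_zero_right hg]⟩

section Expectation

variable {Ω S : Type*} [MeasurableSpace Ω] [MeasurableSpace S] {P : Measure Ω}
  {α θ₀ β θ : ℝ} {ν : Measure S} {L : ℕ} {U : ℕ → Ω → ℝ} {ξ : ℕ → Ω → S}
  {U' : Fin L → ℕ → Ω → ℝ} {I : Fin L → ℕ → Ω → ℕ}

theorem prod_massMoment_zero (hβ0 : 0 < β) (hβ1 : β < 1) (hθ : 0 < θ) {u : ℕ → ℝ}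
    (hu : ∑' k, weight u k = 1) {i i' : ℕ} (hi : i ≠ i') {K : ℕ} {n : Fin L → ℕ}
    (hn : ∀ g, n g < K) :
    ∏ g, massMoment β (labelLaw u) i i' θ (n g) 0 =
      ∑ s ∈ Fintype.piFinset fun _ : Fin L => Finset.range K,
        ENNReal.ofReal (∏ g, (blockFactor β θ (s g) (n g) * normCoeff β (n g) (s g))) *
          weight u i ^ (∑ g, s g) := by
  have hc : ∀ n j, 0 ≤ blockFactor β θ j n * normCoeff β n j := fun n j =>
    mul_nonneg (blockFactor_nonneg hβ0.le hθ _ _) (normCoeff_nonneg hβ0.le hβ1.le _ _)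
  have h1 : ∀ g, massMoment β (labelLaw u) i i' θ (n g) 0 = ∑ j ∈ Finset.range K,
      ENNReal.ofReal (blockFactor β θ j (n g) * normCoeff β (n g) j) * weight u i ^ j := by
    intro g
    have hK : 0 < K := (Nat.zero_le _).trans_lt (hn g)
    rw [massMoment_eq hβ0 hβ1 hθ _ hi (hn g) hK, groupMoment_zero_right β θ hK,
      ENNReal.ofReal_sum_of_nonneg fun j _ => mul_nonneg (pow_nonneg measureReal_nonneg _) (hc _ _)]
    refine Finset.sum_congr rfl fun j _ => ?_
    rw [ENNReal.ofReal_mul (pow_nonneg measureReal_nonneg _),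
      ENNReal.ofReal_pow measureReal_nonneg, ofReal_measureReal, labelLaw_singleton hu, mul_comm]
  simp_rw [h1]
  rw [Finset.prod_univ_sum]
  refine Finset.sum_congr rfl fun s _ => ?_
  rw [Finset.prod_mul_distrib, Finset.prod_pow_eq_pow_sum,
    ENNReal.ofReal_prod_of_nonneg fun g _ => hc _ _]

theorem prod_massMoment (hβ0 : 0 < β) (hβ1 : β < 1) (hθ : 0 < θ) {u : ℕ → ℝ}
    (hu : ∑' k, weight u k = 1) {i i' : ℕ} (hi : i ≠ i') {K : ℕ} {n n' : Fin L → ℕ}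
    (hn : ∀ g, n g < K) (hn' : ∀ g, n' g < K) :
    ∏ g, massMoment β (labelLaw u) i i' θ (n g) (n' g) =
      ∑ s ∈ Fintype.piFinset fun _ : Fin L => Finset.range K,
        ∑ s' ∈ Fintype.piFinset fun _ : Fin L => Finset.range K,
          ENNReal.ofReal (∏ g, (blockFactor β θ (s g + s' g) (n g + n' g) *
            (normCoeff β (n g) (s g) * normCoeff β (n' g) (s' g)))) *
          (weight u i ^ (∑ g, s g) * weight u i' ^ (∑ g, s' g)) := by
  have hc : ∀ n n' j j', 0 ≤ blockFactor β θ (j + j') (n + n') *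
      (normCoeff β n j * normCoeff β n' j') := fun n n' j j' =>
    mul_nonneg (blockFactor_nonneg hβ0.le hθ _ _)
      (mul_nonneg (normCoeff_nonneg hβ0.le hβ1.le _ _) (normCoeff_nonneg hβ0.le hβ1.le _ _))
  have hpq : ∀ j j', 0 ≤ (labelLaw u).real {i} ^ j * (labelLaw u).real {i'} ^ j' := fun j j' =>
    mul_nonneg (pow_nonneg measureReal_nonneg _) (pow_nonneg measureReal_nonneg _)
  have h1 : ∀ g, massMoment β (labelLaw u) i i' θ (n g) (n' g) =
      ∑ j ∈ Finset.range K, ∑ j' ∈ Finset.range K,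
        ENNReal.ofReal (blockFactor β θ (j + j') (n g + n' g) *
          (normCoeff β (n g) j * normCoeff β (n' g) j')) * (weight u i ^ j * weight u i' ^ j') := by
    intro g
    rw [massMoment_eq hβ0 hβ1 hθ _ hi (hn g) (hn' g), groupMoment,
      ENNReal.ofReal_sum_of_nonneg fun j _ => Finset.sum_nonneg fun j' _ =>
        mul_nonneg (hpq _ _) (hc _ _ _ _)]
    refine Finset.sum_congr rfl fun j _ => ?_
    rw [ENNReal.ofReal_sum_of_nonneg fun j' _ => mul_nonneg (hpq _ _) (hc _ _ _ _)]
    refine Finset.sum_congr rfl fun j' _ => ?_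
    rw [ENNReal.ofReal_mul (hpq _ _), ENNReal.ofReal_mul (pow_nonneg measureReal_nonneg _),
      ENNReal.ofReal_pow measureReal_nonneg, ENNReal.ofReal_pow measureReal_nonneg,
      ofReal_measureReal, ofReal_measureReal, labelLaw_singleton hu, labelLaw_singleton hu,
      mul_comm]
  simp_rw [h1]
  rw [Finset.prod_univ_sum]
  refine Finset.sum_congr rfl fun s _ => ?_
  rw [Finset.prod_univ_sum]
  refine Finset.sum_congr rfl fun s' _ => ?_
  rw [Finset.prod_mul_distrib, Finset.prod_mul_distrib, Finset.prod_pow_eq_pow_sum,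
    Finset.prod_pow_eq_pow_sum, ENNReal.ofReal_prod_of_nonneg fun g _ => hc _ _ _ _]

theorem IsHierarchical.lintegral_prod_massE [IsProbabilityMeasure P]
    (h : IsHierarchical P α θ₀ β θ ν L U ξ U' I) (hα : α ∈ Set.Ioo (0 : ℝ) 1)
    (hβ : β ∈ Set.Ioo (0 : ℝ) 1) (hθ₀ : -α < θ₀) (hθ : -β < θ) (hL : 1 ≤ L) (i i' : ℕ)
    (n n' : Fin L → ℕ) :
    ∫⁻ ω, ∏ g, (massE (fun k => U' g k ω) (fun k => I g k ω) i ^ n g *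
        massE (fun k => U' g k ω) (fun k => I g k ω) i' ^ n' g) ∂P =
      ∫⁻ u, ∏ g, massMoment β (labelLaw u) i i' θ (n g) (n' g) ∂stickLaw α θ₀ := by
  have h1 := h.lintegral_eq hα hβ hθ₀ hθ hL
    (F := fun z => ∏ g, (massE (z.1.2 g) (fun k => z.2 (g, k)) i ^ n g *
        massE (z.1.2 g) (fun k => z.2 (g, k)) i' ^ n' g))
    (Finset.measurable_prod _ fun g _ => by fun_prop)
  refine h1.trans (lintegral_congr fun u => ?_)
  exact lintegral_groups β θ (labelLaw u)
    (F := fun g w => massE w.1 w.2 i ^ n g * massE w.1 w.2 i' ^ n' g) fun g => by fun_prop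

theorem IsHierarchical.measurable_massE [IsProbabilityMeasure P]
    (h : IsHierarchical P α θ₀ β θ ν L U ξ U' I) (g : Fin L) (i : ℕ) :
    Measurable fun ω => massE (fun k => U' g k ω) (fun k => I g k ω) i := by
  have hU' : ∀ g k, Measurable (U' g k) := fun g => (h.sticks g).measurable
  have hI := h.measurable_label
  fun_prop

theorem IsHierarchical.lintegral_atoms [IsProbabilityMeasure P]
    (h : IsHierarchical P α θ₀ β θ ν L U ξ U' I) (hα : α ∈ Set.Ioo (0 : ℝ) 1)
    (hβ : β ∈ Set.Ioo (0 : ℝ) 1) (hθ₀ : 0 < θ₀) (hθ : 0 < θ) (hL : 1 ≤ L) {K : ℕ}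
    {n : Fin L → ℕ} (hn : ∀ g, n g < K) (hn0 : ∑ g, n g ≠ 0) :
    ∫⁻ ω, ∑' i, ∏ g, massE (fun k => U' g k ω) (fun k => I g k ω) i ^ n g ∂P =
      ENNReal.ofReal (atomMean α θ₀ β θ K n) := by
  have hα' : -α < θ₀ := by linarith [hα.1]
  have hβ' : -β < θ := by linarith [hβ.1]
  have hm := h.measurable_massE
  have hc : ∀ s : Fin L → ℕ,
      0 ≤ ∏ g, (blockFactor β θ (s g) (n g) * normCoeff β (n g) (s g)) := fun s =>
    Finset.prod_nonneg fun g _ =>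
      mul_nonneg (blockFactor_nonneg hβ.1.le hθ _ _) (normCoeff_nonneg hβ.1.le hβ.2.le _ _)
  have h1 : ∀ i, ∫⁻ ω, ∏ g, massE (fun k => U' g k ω) (fun k => I g k ω) i ^ n g ∂P =
      ∫⁻ u, ∑ s ∈ Fintype.piFinset fun _ : Fin L => Finset.range K,
        ENNReal.ofReal (∏ g, (blockFactor β θ (s g) (n g) * normCoeff β (n g) (s g))) *
          weight u i ^ (∑ g, s g) ∂stickLaw α θ₀ := by
    intro i
    have h2 := h.lintegral_prod_massE hα hβ hα' hβ' hL i (i + 1) n 0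
    simp only [Pi.zero_apply, pow_zero, mul_one] at h2
    rw [h2]
    exact lintegral_congr_ae ((h.ae_tsum_weight hα hα' hL).mono fun u hu =>
      prod_massMoment_zero hβ.1 hβ.2 hθ hu i.lt_succ_self.ne hn)
  rw [lintegral_tsum fun i => (Finset.measurable_prod _ fun g _ =>
    (hm g i).pow_const _).aemeasurable]
  simp_rw [h1]
  have hmw : ∀ i a : ℕ, Measurable fun u : ℕ → ℝ => weight u i ^ a := fun i a => by fun_prop
  simp_rw [lintegral_finsetSum _ fun s _ => (hmw _ _).const_mul _,
    lintegral_const_mul _ (hmw _ _)]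
  rw [Summable.tsum_finsetSum fun _ _ => ENNReal.summable, atomMean,
    ENNReal.ofReal_sum_of_nonneg fun s _ => mul_nonneg (hc s) (powerSumMoment_nonneg hα.2 hθ₀ _)]
  refine Finset.sum_congr rfl fun s _ => ?_
  rw [ENNReal.tsum_mul_left, ← lintegral_tsum fun i => by fun_prop, ENNReal.ofReal_mul (hc s)]
  rcases Nat.eq_zero_or_pos (∑ g, s g) with h0 | h0
  · obtain ⟨g, hg⟩ := prod_normCoeff_eq_zero (β := β) hn0 h0
    rw [Finset.prod_eq_zero (Finset.mem_univ g) (by rw [hg, mul_zero])]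
    simp
  · rw [← lintegral_powerSum hα.1 hα.2 hθ₀, Nat.sub_add_cancel h0]
    rfl

open Classical in
theorem IsHierarchical.lintegral_atom_pairs [IsProbabilityMeasure P]
    (h : IsHierarchical P α θ₀ β θ ν L U ξ U' I) (hα : α ∈ Set.Ioo (0 : ℝ) 1)
    (hβ : β ∈ Set.Ioo (0 : ℝ) 1) (hθ₀ : 0 < θ₀) (hθ : 0 < θ) (hL : 1 ≤ L) {K : ℕ}
    {n n' : Fin L → ℕ} (hn : ∀ g, n g < K) (hn' : ∀ g, n' g < K) (hn0 : ∑ g, n g ≠ 0)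
    (hn0' : ∑ g, n' g ≠ 0) :
    ∫⁻ ω, ∑' i, ∑' i', (if i = i' then 0 else
        ∏ g, (massE (fun k => U' g k ω) (fun k => I g k ω) i ^ n g *
          massE (fun k => U' g k ω) (fun k => I g k ω) i' ^ n' g)) ∂P =
      ENNReal.ofReal (atomPairMean α θ₀ β θ K n n') := by
  have hα' : -α < θ₀ := by linarith [hα.1]
  have hβ' : -β < θ := by linarith [hβ.1]
  have hm := h.measurable_massE
  have hc : ∀ s s' : Fin L → ℕ, 0 ≤ ∏ g, (blockFactor β θ (s g + s' g) (n g + n' g) *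
      (normCoeff β (n g) (s g) * normCoeff β (n' g) (s' g))) := fun s s' =>
    Finset.prod_nonneg fun g _ => mul_nonneg (blockFactor_nonneg hβ.1.le hθ _ _)
      (mul_nonneg (normCoeff_nonneg hβ.1.le hβ.2.le _ _) (normCoeff_nonneg hβ.1.le hβ.2.le _ _))
  have hp := pairSumMoment_nonneg hα.1.le hα.2 hθ₀
  have hmp : ∀ i i' : ℕ, Measurable fun ω => if i = i' then 0 else
        ∏ g, (massE (fun k => U' g k ω) (fun k => I g k ω) i ^ n g *
          massE (fun k => U' g k ω) (fun k => I g k ω) i' ^ n' g) := by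
    intro i i'
    split_ifs
    · exact measurable_const
    · exact Finset.measurable_prod _ fun g _ => ((hm g i).pow_const _).mul ((hm g i').pow_const _)
  have hmw : ∀ (i i' : ℕ) (a b : ℕ), Measurable fun u : ℕ → ℝ =>
      if i = i' then (0 : ℝ≥0∞) else weight u i ^ a * weight u i' ^ b := by
    intro i i' a b
    split_ifs <;> fun_prop
  have h1 : ∀ i i', ∫⁻ ω, (if i = i' then 0 else
        ∏ g, (massE (fun k => U' g k ω) (fun k => I g k ω) i ^ n g *
          massE (fun k => U' g k ω) (fun k => I g k ω) i' ^ n' g)) ∂P =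
      ∫⁻ u, ∑ s ∈ Fintype.piFinset fun _ : Fin L => Finset.range K,
        ∑ s' ∈ Fintype.piFinset fun _ : Fin L => Finset.range K,
          ENNReal.ofReal (∏ g, (blockFactor β θ (s g + s' g) (n g + n' g) *
            (normCoeff β (n g) (s g) * normCoeff β (n' g) (s' g)))) *
          (if i = i' then 0 else weight u i ^ (∑ g, s g) * weight u i' ^ (∑ g, s' g))
            ∂stickLaw α θ₀ := by
    intro i i'
    split_ifs with hi
    · simp
    · rw [h.lintegral_prod_massE hα hβ hα' hβ' hL i i' n n']
      exact lintegral_congr_ae ((h.ae_tsum_weight hα hα' hL).mono fun u hu =>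
        prod_massMoment hβ.1 hβ.2 hθ hu hi hn hn')
  rw [lintegral_tsum fun i => (Measurable.tsum fun i' => hmp i i').aemeasurable]
  simp_rw [lintegral_tsum fun i' => (hmp _ i').aemeasurable, h1]
  simp_rw [lintegral_finsetSum _ fun s _ =>
      (Finset.measurable_sum _ fun s' _ => (hmw _ _ _ _).const_mul _),
    lintegral_finsetSum _ fun s _ => ((hmw _ _ _ _).const_mul _),
    lintegral_const_mul _ (hmw _ _ _ _)]
  simp_rw [Summable.tsum_finsetSum fun _ _ => ENNReal.summable, ENNReal.tsum_mul_left]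
  rw [atomPairMean, ENNReal.ofReal_sum_of_nonneg fun s _ => Finset.sum_nonneg fun s' _ =>
    mul_nonneg (hc s s') (hp _ _)]
  refine Finset.sum_congr rfl fun s _ => ?_
  rw [ENNReal.ofReal_sum_of_nonneg fun s' _ => mul_nonneg (hc s s') (hp _ _)]
  refine Finset.sum_congr rfl fun s' _ => ?_
  rw [ENNReal.ofReal_mul (hc s s')]
  rcases Nat.eq_zero_or_pos (∑ g, s g) with h0 | h0
  · obtain ⟨g, hg⟩ := prod_normCoeff_eq_zero (β := β) hn0 h0
    rw [Finset.prod_eq_zero (Finset.mem_univ g) (by rw [hg, zero_mul, mul_zero])]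
    simp
  rcases Nat.eq_zero_or_pos (∑ g, s' g) with h0' | h0'
  · obtain ⟨g, hg⟩ := prod_normCoeff_eq_zero (β := β) hn0' h0'
    rw [Finset.prod_eq_zero (Finset.mem_univ g) (by rw [hg, mul_zero, mul_zero])]
    simp
  rw [← lintegral_pairSum hα.1 hα.2 hθ₀, Nat.sub_add_cancel h0, Nat.sub_add_cancel h0']
  simp_rw [← lintegral_tsum fun i' => (hmw _ i' _ _).aemeasurable]
  rw [← lintegral_tsum fun i => (Measurable.tsum fun i' => hmw _ _ _ _).aemeasurable]
  congr 1

end Expectation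

/-! ### Limits of the moments -/

/-- The limit of `θ ^ (∑ n_g - 1) * E[∑_i ∏_g Z_{g,i} ^ n_g]`, with the same conventions as in
`atomMean`. -/
def atomLim (α β c : ℝ) (K : ℕ) {L : ℕ} (n : Fin L → ℕ) : ℝ :=
  ∑ s ∈ Fintype.piFinset fun _ : Fin L => Finset.range K,
    (∏ g, normCoeff β (n g) (s g)) * (rising (1 - α) (∑ g, s g - 1) / c ^ (∑ g, s g - 1))

section Limits

variable {T : Type*} {l : Filter T} {θ₀ θ : T → ℝ} {α β c : ℝ}

theorem tendsto_add_div_self (hθ : Tendsto θ l atTop) (x : ℝ) :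
    Tendsto (fun t => (θ t + x) / θ t) l (𝓝 1) := by
  have h1 : Tendsto (fun t => 1 + x / θ t) l (𝓝 (1 + 0)) :=
    tendsto_const_nhds.add (tendsto_const_nhds.div_atTop hθ)
  rw [add_zero] at h1
  refine h1.congr' ?_
  filter_upwards [hθ.eventually_gt_atTop 0] with t ht
  field_simp

theorem tendsto_blockFactor (hθ : Tendsto θ l atTop) (β : ℝ) (j n : ℕ) :
    Tendsto (fun t => θ t ^ n / θ t ^ j * blockFactor β (θ t) j n) l (𝓝 1) := by
  have h1 : Tendsto (fun t => ∏ i ∈ Finset.range j, (θ t + i * β) / θ t) l (𝓝 1) := by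
    simpa using tendsto_finsetProd (Finset.range j) fun (i : ℕ) _ =>
      tendsto_add_div_self hθ (i * β)
  have h2 : Tendsto (fun t => ∏ i ∈ Finset.range n, (θ t + i) / θ t) l (𝓝 1) := by
    simpa using tendsto_finsetProd (Finset.range n) fun (i : ℕ) _ => tendsto_add_div_self hθ i
  have h3 := h1.div h2 one_ne_zero
  rw [div_one] at h3
  refine h3.congr' ?_
  filter_upwards [hθ.eventually_gt_atTop 0] with t ht
  have h4 := (rising_pos ht n).ne'
  simp only [Pi.div_apply, Finset.prod_div_distrib, Finset.prod_const, Finset.card_range]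
  rw [blockFactor, ← rising, ← stepProd]
  field_simp

theorem tendsto_rising_div_pow (hθ : Tendsto θ l atTop)
    (hr : Tendsto (fun t => θ₀ t / θ t) l (𝓝 c)) (k : ℕ) :
    Tendsto (fun t => rising (θ₀ t + 1) k / θ t ^ k) l (𝓝 (c ^ k)) := by
  have h0 : ∀ x : ℝ, Tendsto (fun t => (θ₀ t + 1 + x) / θ t) l (𝓝 c) := by
    intro x
    have h1 : Tendsto (fun t => θ₀ t / θ t + (1 + x) / θ t) l (𝓝 (c + 0)) :=
      hr.add (tendsto_const_nhds.div_atTop hθ)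
    rw [add_zero] at h1
    refine h1.congr fun t => ?_
    ring
  have h1 : Tendsto (fun t => ∏ i ∈ Finset.range k, (θ₀ t + 1 + i) / θ t) l (𝓝 (c ^ k)) := by
    simpa using tendsto_finsetProd (Finset.range k) fun (i : ℕ) _ => h0 i
  refine h1.congr fun t => ?_
  simp [rising, Finset.prod_div_distrib]

theorem tendsto_powerSumMoment (hθ : Tendsto θ l atTop) (hc : 0 < c)
    (hr : Tendsto (fun t => θ₀ t / θ t) l (𝓝 c)) (α : ℝ) (k : ℕ) :
    Tendsto (fun t => θ t ^ k * powerSumMoment α (θ₀ t) k) l (𝓝 (rising (1 - α) k / c ^ k)) := by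
  have h := (tendsto_const_nhds (x := rising (1 - α) k)).div (tendsto_rising_div_pow hθ hr k)
    (pow_pos hc k).ne'
  refine h.congr fun t => ?_
  simp only [Pi.div_apply]
  rw [powerSumMoment, div_div_eq_mul_div]
  ring

theorem tendsto_pairSumMoment (hθ₀ : Tendsto θ₀ l atTop) (hθ : Tendsto θ l atTop) (hc : 0 < c)
    (hr : Tendsto (fun t => θ₀ t / θ t) l (𝓝 c)) (α : ℝ) (k k' : ℕ) :
    Tendsto (fun t => θ t ^ k * θ t ^ k' * pairSumMoment α (θ₀ t) k k') l
      (𝓝 (rising (1 - α) k / c ^ k * (rising (1 - α) k' / c ^ k'))) := by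
  have h1 := (tendsto_const_nhds (x := rising (1 - α) k * rising (1 - α) k')).div
    (tendsto_rising_div_pow hθ hr (k + k')) (pow_pos hc (k + k')).ne'
  have h2 := (tendsto_add_div_self hθ₀ α).div
    (tendsto_add_div_self hθ₀ (1 + ((k + k' : ℕ) : ℝ))) one_ne_zero
  have h3 := h1.mul h2
  rw [div_one, mul_one, pow_add, mul_div_mul_comm] at h3
  refine h3.congr' ?_
  filter_upwards [hθ₀.eventually_gt_atTop 0, hθ.eventually_gt_atTop 0] with t ht₀ ht
  simp only [Pi.div_apply]
  have h4 := (rising_pos (show 0 < θ₀ t + 1 by linarith) (k + k')).ne'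
  have h5 : θ₀ t + (1 + ((k + k' : ℕ) : ℝ)) ≠ 0 := by positivity
  rw [pairSumMoment, rising_succ, pow_add, add_assoc (θ₀ t) 1]
  field_simp

theorem tendsto_atomMean (hθ : Tendsto θ l atTop) (hc : 0 < c)
    (hr : Tendsto (fun t => θ₀ t / θ t) l (𝓝 c)) (α β : ℝ) (K : ℕ) {L : ℕ} {n : Fin L → ℕ}
    (hn : ∑ g, n g ≠ 0) :
    Tendsto (fun t => θ t ^ (∑ g, n g - 1) * atomMean α (θ₀ t) β (θ t) K n) l
      (𝓝 (atomLim α β c K n)) := by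
  simp_rw [atomMean, Finset.mul_sum]
  refine tendsto_finsetSum _ fun s _ => ?_
  rcases Nat.eq_zero_or_pos (∑ g, s g) with h0 | h0
  · obtain ⟨g, hg⟩ := prod_normCoeff_eq_zero (β := β) hn h0
    rw [Finset.prod_eq_zero (Finset.mem_univ g) hg, zero_mul]
    refine tendsto_const_nhds.congr fun t => ?_
    rw [Finset.prod_eq_zero (Finset.mem_univ g) (by rw [hg, mul_zero]), zero_mul, mul_zero]
  have h1 : Tendsto (fun t => ∏ g, (θ t ^ n g / θ t ^ s g * blockFactor β (θ t) (s g) (n g) *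
      normCoeff β (n g) (s g))) l (𝓝 (∏ g, (1 * normCoeff β (n g) (s g)))) :=
    tendsto_finsetProd _ fun g _ => (tendsto_blockFactor hθ β _ _).mul_const _
  simp_rw [one_mul] at h1
  refine (h1.mul (tendsto_powerSumMoment hθ hc hr α (∑ g, s g - 1))).congr' ?_
  filter_upwards [hθ.eventually_gt_atTop 0] with t ht
  obtain ⟨N, hN⟩ := Nat.exists_eq_succ_of_ne_zero hn
  obtain ⟨J, hJ⟩ := Nat.exists_eq_succ_of_ne_zero h0.ne'
  simp only [mul_assoc, Finset.prod_mul_distrib, Finset.prod_div_distrib,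
    Finset.prod_pow_eq_pow_sum]
  rw [hN, hJ]
  simp only [Nat.succ_eq_add_one, Nat.add_sub_cancel, pow_succ]
  field_simp

theorem tendsto_atomPairMean (hθ₀ : Tendsto θ₀ l atTop) (hθ : Tendsto θ l atTop) (hc : 0 < c)
    (hr : Tendsto (fun t => θ₀ t / θ t) l (𝓝 c)) (α β : ℝ) (K : ℕ) {L : ℕ} {n n' : Fin L → ℕ}
    (hn : ∑ g, n g ≠ 0) (hn' : ∑ g, n' g ≠ 0) :
    Tendsto (fun t => θ t ^ (∑ g, n g - 1) * θ t ^ (∑ g, n' g - 1) *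
        atomPairMean α (θ₀ t) β (θ t) K n n') l
      (𝓝 (atomLim α β c K n * atomLim α β c K n')) := by
  rw [atomLim, atomLim, Finset.sum_mul_sum]
  simp_rw [atomPairMean, Finset.mul_sum]
  refine tendsto_finsetSum _ fun s _ => tendsto_finsetSum _ fun s' _ => ?_
  rcases Nat.eq_zero_or_pos (∑ g, s g) with h0 | h0
  · obtain ⟨g, hg⟩ := prod_normCoeff_eq_zero (β := β) hn h0
    rw [Finset.prod_eq_zero (Finset.mem_univ g) hg, zero_mul, zero_mul]
    refine tendsto_const_nhds.congr fun t => ?_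
    rw [Finset.prod_eq_zero (Finset.mem_univ g) (by rw [hg, zero_mul, mul_zero]), zero_mul,
      mul_zero]
  rcases Nat.eq_zero_or_pos (∑ g, s' g) with h0' | h0'
  · obtain ⟨g, hg⟩ := prod_normCoeff_eq_zero (β := β) hn' h0'
    rw [Finset.prod_eq_zero (f := fun g => normCoeff β (n' g) (s' g)) (Finset.mem_univ g) hg,
      zero_mul, mul_zero]
    refine tendsto_const_nhds.congr fun t => ?_
    rw [Finset.prod_eq_zero (Finset.mem_univ g) (by rw [hg, mul_zero, mul_zero]), zero_mul,
      mul_zero]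
  have h1 : Tendsto (fun t => ∏ g, (θ t ^ (n g + n' g) / θ t ^ (s g + s' g) *
      blockFactor β (θ t) (s g + s' g) (n g + n' g) *
      (normCoeff β (n g) (s g) * normCoeff β (n' g) (s' g)))) l
      (𝓝 (∏ g, (1 * (normCoeff β (n g) (s g) * normCoeff β (n' g) (s' g))))) :=
    tendsto_finsetProd _ fun g _ => (tendsto_blockFactor hθ β _ _).mul_const _
  simp_rw [one_mul, Finset.prod_mul_distrib] at h1
  have h2 := h1.mul (tendsto_pairSumMoment hθ₀ hθ hc hr α (∑ g, s g - 1) (∑ g, s' g - 1))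
  rw [mul_mul_mul_comm] at h2
  refine h2.congr' ?_
  filter_upwards [hθ.eventually_gt_atTop 0] with t ht
  obtain ⟨N, hN⟩ := Nat.exists_eq_succ_of_ne_zero hn
  obtain ⟨J, hJ⟩ := Nat.exists_eq_succ_of_ne_zero h0.ne'
  obtain ⟨N', hN'⟩ := Nat.exists_eq_succ_of_ne_zero hn'
  obtain ⟨J', hJ'⟩ := Nat.exists_eq_succ_of_ne_zero h0'.ne'
  simp only [pow_add, Finset.prod_mul_distrib, Finset.prod_div_distrib,
    Finset.prod_pow_eq_pow_sum]
  rw [hN, hJ, hN', hJ']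
  simp only [Nat.succ_eq_add_one, Nat.add_sub_cancel, pow_succ]
  field_simp

end Limits

/-! ### The asymptotic mean -/

theorem mem_tuples {n L : ℕ} {f : Fin L → ℕ} : f ∈ tuples n L ↔ ∑ g, f g = n := by
  simp [tuples, Finset.mem_piAntidiag]

theorem le_of_mem_tuples {n L : ℕ} {f : Fin L → ℕ} (hf : f ∈ tuples n L) (g : Fin L) :
    f g ≤ n :=
  mem_tuples.1 hf ▸ Finset.single_le_sum (f := f) (fun _ _ => Nat.zero_le _) (Finset.mem_univ g)

/-- The constant `L ^ m * θ ^ (m - 1) * f`, where `f` is the asymptotic mean. -/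
def meanConst (α β : ℝ) (m L : ℕ) (c : ℝ) : ℝ :=
  ∑ j ∈ Finset.Icc 1 m, coeffA j β m L * (rising (1 - α) (j - 1) / (β ^ j * c ^ (j - 1)))

theorem meanConst_pos {α β c : ℝ} (hα : α < 1) (hβ0 : 0 < β) (hβ1 : β ≤ 1) (hc : 0 < c) {m L : ℕ}
    (hm : 1 ≤ m) (hL : 1 ≤ L) : 0 < meanConst α β m L c := by
  have hC := genFactCoeff_nonneg hβ0.le hβ1
  have hr : ∀ j, 0 < rising (1 - α) (j - 1) / (β ^ j * c ^ (j - 1)) := fun j =>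
    div_pos (rising_pos (sub_pos.2 hα) _) (by positivity)
  have hA : ∀ j, 0 ≤ coeffA j β m L := fun j =>
    Finset.sum_nonneg fun _ _ => Finset.sum_nonneg fun _ _ => Finset.prod_nonneg fun _ _ => hC _ _
  refine Finset.sum_pos' (fun j _ => mul_nonneg (hA j) (hr j).le)
    ⟨m, Finset.mem_Icc.2 ⟨hm, le_rfl⟩, mul_pos ?_ (hr m)⟩
  -- the positive summand: all `m` draws come from one group and fall into `m` blocks
  have hmem : Pi.single (⟨0, hL⟩ : Fin L) m ∈ tuples m L := mem_tuples.2 (by simp)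
  refine Finset.sum_pos' (fun _ _ => Finset.sum_nonneg fun _ _ =>
    Finset.prod_nonneg fun _ _ => hC _ _) ⟨_, hmem, ?_⟩
  refine Finset.sum_pos' (fun _ _ => Finset.prod_nonneg fun _ _ => hC _ _) ⟨_, hmem, ?_⟩
  refine Finset.prod_pos fun g _ => ?_
  rw [genFactCoeff_self]
  positivity

theorem sum_atomLim {α β c : ℝ} {m L K : ℕ} (hm : m ≠ 0) (hK : m < K) :
    ∑ n ∈ tuples m L, atomLim α β c K n = meanConst α β m L c := by
  simp_rw [meanConst, coeffA, Finset.sum_mul]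
  rw [Finset.sum_comm]
  refine Finset.sum_congr rfl fun n hn => ?_
  have hn' : ∑ g, n g = m := mem_tuples.1 hn
  rw [atomLim, ← Finset.sum_filter_add_sum_filter_not _ fun s : Fin L → ℕ =>
    ∑ g, s g ∈ Finset.Icc 1 m]
  have hz : ∑ s ∈ Fintype.piFinset (fun _ : Fin L => Finset.range K) with
      ¬ ∑ g, s g ∈ Finset.Icc 1 m,
      (∏ g, normCoeff β (n g) (s g)) * (rising (1 - α) (∑ g, s g - 1) / c ^ (∑ g, s g - 1)) =
        0 := by
    refine Finset.sum_eq_zero fun s hs => ?_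
    have hs' := (Finset.mem_filter.1 hs).2
    rw [Finset.mem_Icc, not_and_or, not_le, not_le, Nat.lt_one_iff] at hs'
    have : ∃ g, normCoeff β (n g) (s g) = 0 := by
      rcases hs' with h | h
      · exact prod_normCoeff_eq_zero (by rwa [hn']) h
      · obtain ⟨g, _, hg⟩ := Finset.exists_lt_of_sum_lt (hn'.trans_lt h)
        exact ⟨g, normCoeff_eq_zero β hg⟩
    obtain ⟨g, hg⟩ := this
    rw [Finset.prod_eq_zero (Finset.mem_univ g) hg, zero_mul]
  rw [hz, add_zero, ← Finset.sum_fiberwise_of_maps_to (t := Finset.Icc 1 m)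
    (g := fun s : Fin L → ℕ => ∑ g, s g) fun s hs => (Finset.mem_filter.1 hs).2]
  refine Finset.sum_congr rfl fun j hj => ?_
  have hj' := Finset.mem_Icc.1 hj
  have hset : ((Fintype.piFinset fun _ : Fin L => Finset.range K).filter fun s =>
      ∑ g, s g ∈ Finset.Icc 1 m).filter (fun s => ∑ g, s g = j) = tuples j L := by
    ext s
    rw [Finset.mem_filter, Finset.mem_filter, Fintype.mem_piFinset, mem_tuples]
    constructor
    · exact fun h => h.2
    · intro h
      refine ⟨⟨fun g => Finset.mem_range.2 ?_, h ▸ hj⟩, h⟩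
      exact ((le_of_mem_tuples (mem_tuples.2 h) g).trans hj'.2).trans_lt hK
  rw [hset]
  refine Finset.sum_congr rfl fun s hs => ?_
  have hs' : ∑ g, s g = j := mem_tuples.1 hs
  simp only [normCoeff, Finset.prod_div_distrib, Finset.prod_pow_eq_pow_sum, hs']
  rw [div_mul_div_comm, mul_div_assoc]

/-! ### Moments of the homozygosity -/

/-- `L ^ m` times the homozygosity, for extended nonnegative masses. -/
def homE (m L : ℕ) (Z : Fin L → ℕ → ℝ≥0∞) : ℝ≥0∞ :=
  ∑' i, ∑ n ∈ tuples m L, ∏ g, Z g i ^ n g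

theorem homozygosity_toReal {m L : ℕ} {Z : Fin L → ℕ → ℝ≥0∞} (hZ : ∀ g i, Z g i ≠ ⊤) :
    homozygosity m L (fun g i => (Z g i).toReal) = 1 / (L : ℝ) ^ m * (homE m L Z).toReal := by
  have hp : ∀ i (n : Fin L → ℕ), ∏ g, Z g i ^ n g ≠ ⊤ := fun i n =>
    ENNReal.prod_ne_top fun g _ => ENNReal.pow_ne_top (hZ g i)
  rw [homE, ENNReal.tsum_toReal_eq fun i => ENNReal.sum_ne_top.2 fun n _ => hp i n,
    ← tsum_mul_left, homozygosity]
  refine tsum_congr fun i => ?_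
  rw [ENNReal.toReal_sum fun n _ => hp i n, Finset.mul_sum]
  simp only [ENNReal.toReal_prod, ENNReal.toReal_pow]

theorem homE_eq_sum (m L : ℕ) (Z : Fin L → ℕ → ℝ≥0∞) :
    homE m L Z = ∑ n ∈ tuples m L, ∑' i, ∏ g, Z g i ^ n g := by
  rw [homE, Summable.tsum_finsetSum fun _ _ => ENNReal.summable]

open Classical in
/-- The square of the homozygosity, split into its diagonal and off-diagonal parts. -/
theorem homE_sq (m L : ℕ) (Z : Fin L → ℕ → ℝ≥0∞) :
    homE m L Z ^ 2 = ∑ n ∈ tuples m L, ∑ n' ∈ tuples m L,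
      ((∑' i, ∏ g, Z g i ^ (n g + n' g)) +
        ∑' i, ∑' i', if i = i' then 0 else ∏ g, (Z g i ^ n g * Z g i' ^ n' g)) := by
  rw [homE_eq_sum, sq, Finset.sum_mul_sum]
  refine Finset.sum_congr rfl fun n _ => Finset.sum_congr rfl fun n' _ => ?_
  rw [← ENNReal.tsum_mul_right, ← ENNReal.tsum_add]
  refine tsum_congr fun i => ?_
  have h1 : ∏ g, Z g i ^ (n g + n' g) =
      ∑' i', if i = i' then ∏ g, (Z g i ^ n g * Z g i' ^ n' g) else 0 := by
    rw [tsum_eq_single i fun i' hi' => if_neg hi'.symm, if_pos rfl]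
    simp only [pow_add]
  rw [h1, ← ENNReal.tsum_add, ← ENNReal.tsum_mul_left]
  refine tsum_congr fun i' => ?_
  rw [← Finset.prod_mul_distrib]
  split_ifs <;> simp

theorem atomMean_nonneg {α θ₀ β θ : ℝ} (hα : α < 1) (hβ0 : 0 ≤ β) (hβ1 : β ≤ 1) (hθ₀ : 0 < θ₀)
    (hθ : 0 < θ) (K : ℕ) {L : ℕ} (n : Fin L → ℕ) : 0 ≤ atomMean α θ₀ β θ K n :=
  Finset.sum_nonneg fun _ _ => mul_nonneg (Finset.prod_nonneg fun _ _ =>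
    mul_nonneg (blockFactor_nonneg hβ0 hθ _ _) (normCoeff_nonneg hβ0 hβ1 _ _))
    (powerSumMoment_nonneg hα hθ₀ _)

theorem atomPairMean_nonneg {α θ₀ β θ : ℝ} (hα0 : 0 ≤ α) (hα : α < 1) (hβ0 : 0 ≤ β) (hβ1 : β ≤ 1)
    (hθ₀ : 0 < θ₀) (hθ : 0 < θ) (K : ℕ) {L : ℕ} (n n' : Fin L → ℕ) :
    0 ≤ atomPairMean α θ₀ β θ K n n' :=
  Finset.sum_nonneg fun _ _ => Finset.sum_nonneg fun _ _ => mul_nonneg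
    (Finset.prod_nonneg fun _ _ => mul_nonneg (blockFactor_nonneg hβ0 hθ _ _)
      (mul_nonneg (normCoeff_nonneg hβ0 hβ1 _ _) (normCoeff_nonneg hβ0 hβ1 _ _)))
    (pairSumMoment_nonneg hα0 hα hθ₀ _ _)

section HomMoments

variable {Ω S : Type*} [MeasurableSpace Ω] [MeasurableSpace S] {P : Measure Ω}
  [IsProbabilityMeasure P] {α θ₀ β θ : ℝ} {ν : Measure S} {L : ℕ} {U : ℕ → Ω → ℝ}
  {ξ : ℕ → Ω → S} {U' : Fin L → ℕ → Ω → ℝ} {I : Fin L → ℕ → Ω → ℕ}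

theorem IsHierarchical.lintegral_homE (h : IsHierarchical P α θ₀ β θ ν L U ξ U' I)
    (hα : α ∈ Set.Ioo (0 : ℝ) 1) (hβ : β ∈ Set.Ioo (0 : ℝ) 1) (hθ₀ : 0 < θ₀) (hθ : 0 < θ)
    (hL : 1 ≤ L) {m K : ℕ} (hm : m ≠ 0) (hK : m < K) :
    ∫⁻ ω, homE m L (fun g => massE (fun k => U' g k ω) (fun k => I g k ω)) ∂P =
      ENNReal.ofReal (∑ n ∈ tuples m L, atomMean α θ₀ β θ K n) := by
  have hmZ := h.measurable_massE
  simp_rw [homE_eq_sum]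
  rw [lintegral_finsetSum _ fun n _ => Measurable.tsum fun i =>
      Finset.measurable_prod _ fun g _ => (hmZ g i).pow_const _,
    ENNReal.ofReal_sum_of_nonneg fun n _ => atomMean_nonneg hα.2 hβ.1.le hβ.2.le hθ₀ hθ K n]
  refine Finset.sum_congr rfl fun n hn => ?_
  exact h.lintegral_atoms hα hβ hθ₀ hθ hL (fun g => (le_of_mem_tuples hn g).trans_lt hK)
    (by rwa [mem_tuples.1 hn])

theorem IsHierarchical.lintegral_homE_sq (h : IsHierarchical P α θ₀ β θ ν L U ξ U' I)
    (hα : α ∈ Set.Ioo (0 : ℝ) 1) (hβ : β ∈ Set.Ioo (0 : ℝ) 1) (hθ₀ : 0 < θ₀) (hθ : 0 < θ)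
    (hL : 1 ≤ L) {m K : ℕ} (hm : m ≠ 0) (hK : 2 * m < K) :
    ∫⁻ ω, homE m L (fun g => massE (fun k => U' g k ω) (fun k => I g k ω)) ^ 2 ∂P =
      ENNReal.ofReal (∑ n ∈ tuples m L, ∑ n' ∈ tuples m L,
        (atomMean α θ₀ β θ K (fun g => n g + n' g) + atomPairMean α θ₀ β θ K n n')) := by
  classical
  have hmZ := h.measurable_massE
  have h1 : ∀ n : Fin L → ℕ, Measurable fun ω =>
      ∑' i, ∏ g, massE (fun k => U' g k ω) (fun k => I g k ω) i ^ n g := fun n =>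
    Measurable.tsum fun i => Finset.measurable_prod _ fun g _ => (hmZ g i).pow_const _
  have h2 : ∀ n n' : Fin L → ℕ, Measurable fun ω => ∑' i, ∑' i', if i = i' then 0 else
      ∏ g, (massE (fun k => U' g k ω) (fun k => I g k ω) i ^ n g *
        massE (fun k => U' g k ω) (fun k => I g k ω) i' ^ n' g) := by
    refine fun n n' => Measurable.tsum fun i => Measurable.tsum fun i' => ?_
    split_ifs
    · exact measurable_const
    · exact Finset.measurable_prod _ fun g _ =>
        ((hmZ g i).pow_const _).mul ((hmZ g i').pow_const _)
  have hn0 : ∀ n n' : Fin L → ℕ, 0 ≤ atomMean α θ₀ β θ K (fun g => n g + n' g) := fun n n' =>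
    atomMean_nonneg hα.2 hβ.1.le hβ.2.le hθ₀ hθ K _
  have hn0' : ∀ n n' : Fin L → ℕ, 0 ≤ atomPairMean α θ₀ β θ K n n' := fun n n' =>
    atomPairMean_nonneg hα.1.le hα.2 hβ.1.le hβ.2.le hθ₀ hθ K n n'
  have h3 : ∀ n n' : Fin L → ℕ, Measurable fun ω =>
      (∑' i, ∏ g, massE (fun k => U' g k ω) (fun k => I g k ω) i ^ (n g + n' g)) +
        ∑' i, ∑' i', if i = i' then 0 else
          ∏ g, (massE (fun k => U' g k ω) (fun k => I g k ω) i ^ n g *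
            massE (fun k => U' g k ω) (fun k => I g k ω) i' ^ n' g) := fun n n' =>
    (h1 fun g => n g + n' g).add (h2 n n')
  simp_rw [homE_sq]
  rw [lintegral_finsetSum _ fun n _ => Finset.measurable_sum _ fun n' _ => h3 n n',
    ENNReal.ofReal_sum_of_nonneg fun n _ => Finset.sum_nonneg fun n' _ =>
      add_nonneg (hn0 _ _) (hn0' _ _)]
  refine Finset.sum_congr rfl fun n hn => ?_
  rw [lintegral_finsetSum _ fun n' _ => h3 n n',
    ENNReal.ofReal_sum_of_nonneg fun n' _ => add_nonneg (hn0 _ _) (hn0' _ _)]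
  refine Finset.sum_congr rfl fun n' hn' => ?_
  have e1 := le_of_mem_tuples hn
  have e2 := le_of_mem_tuples hn'
  have e3 := mem_tuples.1 hn
  have e4 := mem_tuples.1 hn'
  rw [lintegral_add_left (h1 fun g => n g + n' g), ENNReal.ofReal_add (hn0 _ _) (hn0' _ _),
    h.lintegral_atoms hα hβ hθ₀ hθ hL (K := K) (n := fun g => n g + n' g)
      (fun g => by have := e1 g; have := e2 g; omega)
      (by rw [Finset.sum_add_distrib]; omega),
    h.lintegral_atom_pairs hα hβ hθ₀ hθ hL (K := K) (fun g => by have := e1 g; omega)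
      (fun g => by have := e2 g; omega) (by omega) (by omega)]

end HomMoments

/-! ### Convergence in probability -/

/-- Chebyshev's inequality for `κ X` around `1`, in terms of the first two moments of `X`. -/
theorem measure_le_abs_sub_one_le {Ω : Type*} [MeasurableSpace Ω] {P : Measure Ω}
    [IsProbabilityMeasure P] {X : Ω → ℝ≥0∞} (hX : Measurable X) {a b κ ε : ℝ} (ha : 0 ≤ a)
    (hb : 0 ≤ b) (hκ : 0 ≤ κ) (hε : 0 < ε) (h1 : ∫⁻ ω, X ω ∂P = ENNReal.ofReal a)
    (h2 : ∫⁻ ω, X ω ^ 2 ∂P = ENNReal.ofReal b) :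
    P {ω | ε ≤ |κ * (X ω).toReal - 1|} ≤
      ENNReal.ofReal (κ ^ 2 * b + 1 - 2 * (κ * a)) / ENNReal.ofReal (ε ^ 2) := by
  have hfin : ∀ᵐ ω ∂P, X ω < ⊤ := ae_lt_top hX (by rw [h1]; exact ENNReal.ofReal_ne_top)
  have hX' : Measurable fun ω => (X ω).toReal := hX.ennreal_toReal
  have hm : Measurable fun ω => ENNReal.ofReal ((κ * (X ω).toReal - 1) ^ 2) := by fun_prop
  have hv : ∫⁻ ω, ENNReal.ofReal ((κ * (X ω).toReal - 1) ^ 2) ∂P =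
      ENNReal.ofReal (κ ^ 2 * b + 1 - 2 * (κ * a)) := by
    -- `(κ x - 1) ^ 2 + 2 κ x = κ ^ 2 x ^ 2 + 1`
    have h3 : ∫⁻ ω, ENNReal.ofReal ((κ * (X ω).toReal - 1) ^ 2) ∂P +
        ENNReal.ofReal (2 * (κ * a)) = ENNReal.ofReal (κ ^ 2 * b + 1) := by
      have e1 : ENNReal.ofReal (2 * (κ * a)) = ∫⁻ ω, ENNReal.ofReal (2 * κ) * X ω ∂P := by
        rw [lintegral_const_mul _ hX, h1, ← ENNReal.ofReal_mul (by positivity), mul_assoc]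
      have e2 : ENNReal.ofReal (κ ^ 2 * b + 1) =
          ∫⁻ ω, (ENNReal.ofReal (κ ^ 2) * X ω ^ 2 + 1) ∂P := by
        rw [lintegral_add_right _ measurable_const, lintegral_const_mul _ (hX.pow_const 2), h2,
          ← ENNReal.ofReal_mul (by positivity), ENNReal.ofReal_add (by positivity) zero_le_one]
        simp
      rw [e1, e2, ← lintegral_add_left hm]
      refine lintegral_congr_ae (hfin.mono fun ω hω => ?_)
      obtain ⟨x, hx⟩ : ∃ x, x = (X ω).toReal := ⟨_, rfl⟩
      have hx0 : 0 ≤ x := hx ▸ ENNReal.toReal_nonneg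
      have hXx : X ω = ENNReal.ofReal x := by rw [hx, ENNReal.ofReal_toReal hω.ne]
      simp only [hXx, ENNReal.toReal_ofReal hx0]
      rw [← ENNReal.ofReal_mul (by positivity), ← ENNReal.ofReal_pow hx0,
        ← ENNReal.ofReal_mul (by positivity), ← ENNReal.ofReal_one,
        ← ENNReal.ofReal_add (by positivity) (by positivity),
        ← ENNReal.ofReal_add (by positivity) zero_le_one]
      congr 1
      ring
    rw [ENNReal.ofReal_sub _ (by positivity), ← h3,
      ENNReal.add_sub_cancel_right ENNReal.ofReal_ne_top]
  rw [← hv]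
  refine (measure_mono fun ω hω => ?_).trans (meas_ge_le_lintegral_div hm.aemeasurable
    (by simpa using hε.ne') ENNReal.ofReal_ne_top)
  refine ENNReal.ofReal_le_ofReal ?_
  rw [← sq_abs (κ * _ - 1)]
  exact pow_le_pow_left₀ hε.le hω 2

theorem tendsto_sum_atomMean {T : Type*} {l : Filter T} {θ₀ θ : T → ℝ} {c : ℝ}
    (hθ : Tendsto θ l atTop) (hc : 0 < c) (hr : Tendsto (fun t => θ₀ t / θ t) l (𝓝 c)) (α β : ℝ)
    {m K L : ℕ} (hm : m ≠ 0) (hK : m < K) :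
    Tendsto (fun t => θ t ^ (m - 1) * ∑ n ∈ tuples m L, atomMean α (θ₀ t) β (θ t) K n) l
      (𝓝 (meanConst α β m L c)) := by
  rw [← sum_atomLim hm hK]
  simp_rw [Finset.mul_sum]
  refine tendsto_finsetSum _ fun n hn => ?_
  have := tendsto_atomMean hθ hc hr α β K (n := n) (by rwa [mem_tuples.1 hn])
  rwa [mem_tuples.1 hn] at this

/-- The limit of the scaled second moment of the homozygosity. -/
theorem tendsto_sum_atomPairMean {T : Type*} {l : Filter T} {θ₀ θ : T → ℝ} {c : ℝ}
    (hθ₀ : Tendsto θ₀ l atTop) (hθ : Tendsto θ l atTop) (hc : 0 < c)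
    (hr : Tendsto (fun t => θ₀ t / θ t) l (𝓝 c)) (α β : ℝ) {m K L : ℕ} (hm : m ≠ 0) (hK : m < K) :
    Tendsto (fun t => (θ t ^ (m - 1)) ^ 2 * ∑ n ∈ tuples m L, ∑ n' ∈ tuples m L,
        (atomMean α (θ₀ t) β (θ t) K (fun g => n g + n' g) +
          atomPairMean α (θ₀ t) β (θ t) K n n')) l
      (𝓝 (meanConst α β m L c ^ 2)) := by
  rw [← sum_atomLim hm hK, sq, Finset.sum_mul_sum]
  simp_rw [Finset.mul_sum]
  refine tendsto_finsetSum _ fun n hn => tendsto_finsetSum _ fun n' hn' => ?_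
  have e1 := mem_tuples.1 hn
  have e2 := mem_tuples.1 hn'
  have e3 : ∑ g, (n g + n' g) = 2 * m := by rw [Finset.sum_add_distrib, e1, e2]; ring
  have h1 := tendsto_atomMean hθ hc hr α β K (n := fun g => n g + n' g) (by omega)
  have h2 := tendsto_atomPairMean hθ₀ hθ hc hr α β K (n := n) (n' := n') (by omega) (by omega)
  -- the diagonal part has one factor `θ⁻¹` more
  have h3 := (tendsto_inv_atTop_zero.comp hθ).mul h1
  have h4 := h3.add h2
  rw [zero_mul, zero_add] at h4
  refine h4.congr' ?_
  filter_upwards [hθ.eventually_gt_atTop 0] with t ht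
  obtain ⟨k, rfl⟩ := Nat.exists_eq_succ_of_ne_zero hm
  have e5 : 2 * (k + 1) - 1 = k + k + 1 := by omega
  simp only [Function.comp_apply, e1, e2, e3, Nat.succ_eq_add_one, e5, Nat.add_sub_cancel]
  rw [pow_succ, pow_add]
  field_simp

theorem IsHierarchical.homozygosity_div_asympMean {Ω S : Type*} [MeasurableSpace Ω]
    [MeasurableSpace S] {P : Measure Ω} [IsProbabilityMeasure P] {α θ₀ β θ : ℝ} {ν : Measure S}
    {L : ℕ} {U : ℕ → Ω → ℝ} {ξ : ℕ → Ω → S} {U' : Fin L → ℕ → Ω → ℝ} {I : Fin L → ℕ → Ω → ℕ}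
    (h : IsHierarchical P α θ₀ β θ ν L U ξ U' I) (hβ : β ∈ Set.Ioo (0 : ℝ) 1) (hθ : 0 < θ)
    (hL : 1 ≤ L) (m : ℕ) (c : ℝ) :
    ∀ᵐ ω ∂P, homozygosity m L (fun g => mass (fun k => U' g k ω) (fun j => I g j ω)) /
        asympMean α β θ m L c =
      θ ^ (m - 1) / meanConst α β m L c *
        (homE m L fun g => massE (fun k => U' g k ω) (fun k => I g k ω)).toReal := by
  have h1 : ∀ᵐ ω ∂P, ∀ g k, U' g k ω ∈ Set.Icc (0 : ℝ) 1 := by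
    rw [ae_all_iff]
    intro g
    have h2 := ae_stickLaw_mem_Icc β θ
    rw [← (h.sticks g).map_eq hβ.1.le hβ.2 (by linarith [hβ.1])] at h2
    exact ae_of_ae_map (measurable_pi_iff.2 (h.sticks g).measurable).aemeasurable h2
  refine h1.mono fun ω hω => ?_
  have hL' : (L : ℝ) ≠ 0 := by exact_mod_cast (Nat.one_le_iff_ne_zero.1 hL)
  have h2 := homozygosity_toReal (m := m)
    (Z := fun g => massE (fun k => U' g k ω) (fun k => I g k ω))
    fun g i => ne_top_of_le_ne_top ENNReal.one_ne_top (massE_le_one (hω g) _ i)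
  have h3 : (fun g => mass (fun k => U' g k ω) (fun j => I g j ω)) =
      fun g i => (massE (fun k => U' g k ω) (fun k => I g k ω) i).toReal := by
    funext g i
    exact mass_eq_toReal _ _ _
  rw [h3, h2, asympMean, ← meanConst]
  field_simp

end HPYP

end

theorem proposition3p2
    {S : Type*} [TopologicalSpace S] [PolishSpace S] [MeasurableSpace S] [BorelSpace S]
    (ν : Measure S) [IsProbabilityMeasure ν]
    (α β c : ℝ) (hα : α ∈ Set.Ioo (0 : ℝ) 1) (hβ : β ∈ Set.Ioo (0 : ℝ) 1) (hc : 0 < c)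
    (m L : ℕ) (hm : 2 ≤ m) (hL : 1 ≤ L)
    -- the parameters, indexed by `t : T` and tending to infinity along the filter `l`
    {T : Type*} (l : Filter T) (θ₀ θ : T → ℝ)
    (hθ₀ : ∀ t, -α < θ₀ t) (hθ : ∀ t, -β < θ t)
    (hθ₀_lim : Tendsto θ₀ l atTop) (hθ_lim : Tendsto θ l atTop)
    (hratio : Tendsto (fun t => θ₀ t / θ t) l (𝓝 c))
    -- for every `t`, a hierarchical Pitman-Yor process on some probability space
    {Ω : T → Type*} [∀ t, MeasurableSpace (Ω t)]
    (P : ∀ t, Measure (Ω t)) [∀ t, IsProbabilityMeasure (P t)]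
    (U : ∀ t, ℕ → Ω t → ℝ) (ξ : ∀ t, ℕ → Ω t → S)
    (U' : ∀ t, Fin L → ℕ → Ω t → ℝ) (I : ∀ t, Fin L → ℕ → Ω t → ℕ)
    (hH : ∀ t, HPYP.IsHierarchical (P t) α (θ₀ t) β (θ t) ν L (U t) (ξ t) (U' t) (I t)) :
    ∀ ε : ℝ, 0 < ε →
      Tendsto
        (fun t => P t {ω | ε ≤ |HPYP.homozygosity m L
              (fun g => HPYP.mass (fun k => U' t g k ω) (fun j => I t g j ω)) /
            HPYP.asympMean α β (θ t) m L c - 1|})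
        l (𝓝 0) := by

  intro ε hε
  have hm0 : m ≠ 0 := by omega
  have hK : 2 * m < 2 * m + 1 := Nat.lt_succ_self _
  have hK' : m < 2 * m + 1 := by omega
  have hw := HPYP.meanConst_pos hα.2 hβ.1 hβ.2.le hc (Nat.one_le_iff_ne_zero.2 hm0) hL
  set w := HPYP.meanConst α β m L c
  set a : T → ℝ := fun t => ∑ n ∈ HPYP.tuples m L, HPYP.atomMean α (θ₀ t) β (θ t) (2 * m + 1) n
  set b : T → ℝ := fun t => ∑ n ∈ HPYP.tuples m L, ∑ n' ∈ HPYP.tuples m L,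
    (HPYP.atomMean α (θ₀ t) β (θ t) (2 * m + 1) (fun g => n g + n' g) +
      HPYP.atomPairMean α (θ₀ t) β (θ t) (2 * m + 1) n n')
  have ha : Tendsto (fun t => θ t ^ (m - 1) / w * a t) l (𝓝 1) := by
    have h := (HPYP.tendsto_sum_atomMean (L := L) hθ_lim hc hratio α β hm0 hK').div_const w
    rw [div_self hw.ne'] at h
    exact h.congr fun t => by ring
  have hb : Tendsto (fun t => (θ t ^ (m - 1) / w) ^ 2 * b t) l (𝓝 1) := by
    have h := (HPYP.tendsto_sum_atomPairMean (L := L) hθ₀_lim hθ_lim hc hratio α β hm0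
      hK').div_const (w ^ 2)
    rw [div_self (pow_ne_zero 2 hw.ne')] at h
    exact h.congr fun t => by ring
  have hlim : Tendsto (fun t => ENNReal.ofReal ((θ t ^ (m - 1) / w) ^ 2 * b t + 1 -
      2 * (θ t ^ (m - 1) / w * a t)) / ENNReal.ofReal (ε ^ 2)) l (𝓝 0) := by
    have h := ENNReal.tendsto_ofReal ((hb.add_const 1).sub (ha.const_mul 2))
    norm_num at h
    have h' := ENNReal.Tendsto.div_const (b := ENNReal.ofReal (ε ^ 2)) h
      (Or.inr (by simpa using hε.ne'))
    rwa [ENNReal.zero_div] at h'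
  refine tendsto_of_tendsto_of_tendsto_of_le_of_le' tendsto_const_nhds hlim
    (Eventually.of_forall fun t => zero_le) ?_
  filter_upwards [hθ₀_lim.eventually_gt_atTop 0, hθ_lim.eventually_gt_atTop 0] with t ht₀ ht
  have hmZ := (hH t).measurable_massE
  have hX : Measurable fun ω => HPYP.homE m L fun g =>
      HPYP.massE (fun k => U' t g k ω) (fun k => I t g k ω) :=
    Measurable.tsum fun i => Finset.measurable_sum _ fun n _ =>
      Finset.measurable_prod _ fun g _ => (hmZ g i).pow_const _
  have h0 : ∀ n, 0 ≤ HPYP.atomMean α (θ₀ t) β (θ t) (2 * m + 1) (L := L) n :=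
    HPYP.atomMean_nonneg hα.2 hβ.1.le hβ.2.le ht₀ ht _
  have h0' : ∀ n n', 0 ≤ HPYP.atomPairMean α (θ₀ t) β (θ t) (2 * m + 1) (L := L) n n' :=
    HPYP.atomPairMean_nonneg hα.1.le hα.2 hβ.1.le hβ.2.le ht₀ ht _
  refine le_trans (le_of_eq (measure_congr ?_)) (HPYP.measure_le_abs_sub_one_le hX
    (Finset.sum_nonneg fun n _ => h0 n)
    (Finset.sum_nonneg fun n _ => Finset.sum_nonneg fun n' _ => add_nonneg (h0 _) (h0' n n'))
    (div_nonneg (pow_nonneg ht.le _) hw.le) hε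
    ((hH t).lintegral_homE hα hβ ht₀ ht hL hm0 hK')
    ((hH t).lintegral_homE_sq hα hβ ht₀ ht hL hm0 hK))
  filter_upwards [(hH t).homozygosity_div_asympMean hβ ht hL m c] with ω hω
  exact congrArg (fun x : ℝ => ε ≤ |x - 1|) hω
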